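/- Let $d\ge 2$ and $E>0$. For $N\in\mathbb{N}$ let $\hbar=\hbar_N>0$ be given by $E=\hbar\,(N+d/2)$. Let $\gamma_0(t)=\sqrt{E}\,(\cos t,\sin t,0,\dots,0;\,-\sin t,\cos t,0,\dots,0)\in T^*\mathbb{R}^d=\mathbb{R}^d_x\times\mathbb{R}^d_\xi$, and let $$\varphi_{N,d}^{\gamma_0}(x)=\frac{1}{(\hbar\pi)^{\frac{d-2}{4}}\hbar^{\frac{N+1}{2}}\sqrt{\pi N!}}\,(x_1+ix_2)^N e^{-\frac{|x|^2}{2\hbar}}.$$ Let $\gamma:\mathbb{R}\to T^*\mathbb{R}^d$ be any orbit of the Hamiltonian $H(x,\xi)=\tfrac12|\xi|^2+\tfrac12|x|^2$ (i.e. $\dot x=\xi$, $\dot\xi=-x$) with energy $H(\gamma(t))=E$. Let $\operatorname{SU}(d)$ act on $T^*\mathbb{R}^d\cong\mathbb{C}^d$, $(x,\xi)\mapsto x+i\xi$. For $U\in \operatorname{SU}(d)$ let $\mu(U)$ denote the metaplectic operator of $U$: the unitary operator on $L^2(\mathbb{R}^d)$, determined up to a phase factor, with $\mu(U)\rho_\hbar(w)\mu(U)^{-1}=\rho_\hbar(Uw)$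 for all $w\in T^*\mathbb{R}^d$, where $\rho_\hbar(q,p)f(x)=e^{\frac{i}{\hbar}(\langle p,x\rangle-\frac12\langle p,q\rangle)}f(x-q)$. Then there are a $U\in\operatorname{SU}(d)$ with $U\cdot\gamma_0=\gamma$ (as orbits, i.e. up to the choice of the starting point) and, for every $N$, a metaplectic operator $\mu(U)$; so for every $N$ there is an orbital coherent state $\varphi_{N,d}^{\gamma}=\mu(U)\varphi_{N,d}^{\gamma_0}$ centered at $\gamma$. For any choice of these states (of $U$ and of the phase of $\mu(U)$, possibly depending on $N$), let $$W_{\varphi_{N,d}^{\gamma},\varphi_{N,d}^{\gamma}}(x,\xi)=\frac{1}{(2\pi\hbar)^d}\int_{\mathbb{R}^d}\varphi_{N,d}^{\gamma}(x+\tfrac v2)\,\overline{\varphi_{N,d}^{\gamma}(x-\tfrac v2)}\,e^{-\frac{i}{\hbar}\langle v,\xi\rangle}\,dv$$ be the Wigner distribution. Then for every smooth $a:T^*\mathbb{R}^d\to\mathbb{R}$ with exponential decay (there are $C$ and $c>0$ with $|a(x,\xi)|\le Ce^{-c(|x|+|\xi|)}$ for all $(x,\xi)$), the function $a\,W_{\varphi_{N,d}^{\gamma},\varphi_{N,d}^{\gamma}}$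 is integrable on $T^*\mathbb{R}^d$ for every $N$, and, as $N\to\infty$ with $E$ fixed, $$\int_{T^*\mathbb{R}^d}a(x,\xi)\,W_{\varphi_{N,d}^{\gamma},\varphi_{N,d}^{\gamma}}(x,\xi)\,dx\,d\xi\;\longrightarrow\;\frac{1}{2\pi}\int_0^{2\pi}a\big(\gamma(t)\big)\,dt .$$ -/

import Mathlib

open MeasureTheory Filter Topology
open scoped ContDiff

noncomputable section

namespace OrbitalCoherent

/-- Configuration space `ℝ^d` with its Euclidean norm. -/
abbrev Conf (d : ℕ) : Type := EuclideanSpace ℝ (Fin d)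

/-- Phase space `T*ℝ^d`, with points `(x, ξ)` and Lebesgue measure `dx dξ`. -/
abbrev Phase (d : ℕ) : Type := Conf d × Conf d

/-- The Hilbert space `L²(ℝ^d)`. -/
abbrev StateSpace (d : ℕ) : Type := Lp ℂ 2 (volume : Measure (Conf d))

/-- The classical Hamiltonian `H(x, ξ) = |ξ|² / 2 + |x|² / 2`. -/
def energy {d : ℕ} (z : Phase d) : ℝ := ‖z.2‖ ^ 2 / 2 + ‖z.1‖ ^ 2 / 2

/-- `γ = (x, ξ)` solves Hamilton's equations `x' = ∂H/∂ξ = ξ`, `ξ' = -∂H/∂x = -x`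
of the isotropic harmonic oscillator. -/
def IsHamiltonianOrbit {d : ℕ} (γ : ℝ → Phase d) : Prop :=
  ∀ t, HasDerivAt (fun s => (γ s).1) (γ t).2 t ∧ HasDerivAt (fun s => (γ s).2) (-(γ t).1) t

/-- The reference orbit `γ₀(t) = √E (cos t, sin t, 0, …, 0; -sin t, cos t, 0, …, 0)`. -/
def refOrbit {d : ℕ} (hd : 2 ≤ d) (E : ℝ) (t : ℝ) : Phase d :=
  (√E • (EuclideanSpace.single ⟨0, by omega⟩ (Real.cos t) +
      EuclideanSpace.single ⟨1, by omega⟩ (Real.sin t)),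
   √E • (EuclideanSpace.single ⟨0, by omega⟩ (-Real.sin t) +
      EuclideanSpace.single ⟨1, by omega⟩ (Real.cos t)))

/-- The action of `SU(d) ⊂ Sp(2d, ℝ)` on phase space, identified with `ℂ^d` by
`(x, ξ) ↦ x + iξ`. -/
def suAct {d : ℕ} (U : Matrix.specialUnitaryGroup (Fin d) ℂ) (z : Phase d) : Phase d :=
  let w : Fin d → ℂ := (U : Matrix (Fin d) (Fin d) ℂ).mulVec fun j => ⟨z.1 j, z.2 j⟩
  (WithLp.toLp 2 fun j => (w j).re, WithLp.toLp 2 fun j => (w j).im)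

/-- The function `x ↦ exp((i/ħ)(⟨p, x⟩ - ⟨p, q⟩ / 2)) f(x - q)`, for `w = (q, p)`. -/
def weylFun {d : ℕ} (ħ : ℝ) (w : Phase d) (f : Conf d → ℂ) (x : Conf d) : ℂ :=
  Complex.exp (((inner ℝ w.2 x - inner ℝ w.2 w.1 / 2) / ħ : ℝ) * Complex.I) * f (x - w.1)

theorem memLp_weylFun {d : ℕ} (ħ : ℝ) (w : Phase d) (f : StateSpace d) :
    MemLp (weylFun ħ w f) 2 volume := by
  have h1 : MemLp (fun x : Conf d => f (x - w.1)) 2 volume :=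
    (Lp.memLp f).comp_measurePreserving (measurePreserving_sub_right volume w.1)
  refine h1.of_le ?_ ?_
  · refine AEStronglyMeasurable.mul ?_ h1.aestronglyMeasurable
    exact Continuous.aestronglyMeasurable (by fun_prop)
  · refine Eventually.of_forall fun x => ?_
    simp only [weylFun, norm_mul, Complex.norm_exp_ofReal_mul_I, one_mul, le_refl]

/-- The operator `ρ_ħ(w)` of the Schrödinger representation on `L²(ℝ^d)`: translation by `w`
in phase space. -/
def weylOp {d : ℕ} (ħ : ℝ) (w : Phase d) (f : StateSpace d) : StateSpace d :=
  (memLp_weylFun ħ w f).toLp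

/-- `T` is a metaplectic operator `μ(U)` of `U ∈ SU(d) ⊂ Sp(2d, ℝ)`: the unitary operator on
`L²(ℝ^d)`, determined up to a phase factor, with `μ(U) ρ_ħ(w) μ(U)⁻¹ = ρ_ħ(U w)` for all `w`. -/
def IsMetaplectic {d : ℕ} (ħ : ℝ) (U : Matrix.specialUnitaryGroup (Fin d) ℂ)
    (T : StateSpace d ≃ₗᵢ[ℂ] StateSpace d) : Prop :=
  ∀ (w : Phase d) (f : StateSpace d), T (weylOp ħ w f) = weylOp ħ (suAct U w) (T f)

/-- The function
`(ħπ)^{-(d-2)/4} ħ^{-(N+1)/2} (π N!)^{-1/2} (x₁ + i x₂)^N exp(-|x|² / (2ħ))`. -/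
def refStateFun {d : ℕ} (hd : 2 ≤ d) (ħ : ℝ) (N : ℕ) (x : Conf d) : ℂ :=
  (((ħ * Real.pi) ^ (((d : ℝ) - 2) / 4) * ħ ^ (((N : ℝ) + 1) / 2) *
      √(Real.pi * (N.factorial : ℝ)))⁻¹ : ℝ) *
    ((x ⟨0, by omega⟩ : ℂ) + Complex.I * (x ⟨1, by omega⟩ : ℂ)) ^ N *
    (Real.exp (-‖x‖ ^ 2 / (2 * ħ)) : ℝ)

theorem memLp_refStateFun {d : ℕ} (hd : 2 ≤ d) {ħ : ℝ} (hħ : 0 < ħ) (N : ℕ) :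
    MemLp (refStateFun hd ħ N) 2 (volume : Measure (Conf d)) := by
  have hcont : Continuous (refStateFun hd ħ N : Conf d → ℂ) := by
    unfold refStateFun
    fun_prop
  have hG : Integrable (fun x : Conf d => Real.exp (-(1 / (2 * ħ)) * ‖x‖ ^ 2)) := by
    have h := (GaussianFourier.integrable_cexp_neg_mul_sq_norm_add (V := Conf d)
      (b := ((1 / (2 * ħ) : ℝ) : ℂ)) (by simpa using hħ) 0 0).norm
    refine h.congr (Eventually.of_forall fun x => ?_)
    simp [Complex.norm_exp, ← Complex.ofReal_pow]
  rw [memLp_two_iff_integrable_sq_norm hcont.aestronglyMeasurable]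
  set K : ℝ := ((ħ * Real.pi) ^ (((d : ℝ) - 2) / 4) * ħ ^ (((N : ℝ) + 1) / 2) *
      √(Real.pi * (N.factorial : ℝ)))⁻¹ with hK
  refine Integrable.mono' (hG.const_mul
    (K ^ 2 * (4 ^ N * ((2 * ħ) ^ N * (N.factorial : ℝ)))))
    (hcont.norm.pow 2).aestronglyMeasurable (Eventually.of_forall fun x => ?_)
  have hx : ‖(x ⟨0, by omega⟩ : ℂ) + Complex.I * (x ⟨1, by omega⟩ : ℂ)‖ ≤ 2 * ‖x‖ := by
    refine (norm_add_le _ _).trans ?_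
    have h0 := PiLp.norm_apply_le x ⟨0, by omega⟩
    have h1 := PiLp.norm_apply_le x ⟨1, by omega⟩
    simp only [norm_mul, Complex.norm_I, one_mul, Complex.norm_real]
    linarith
  have hpow : (‖x‖ ^ 2 / (2 * ħ)) ^ N / (N.factorial : ℝ) ≤ Real.exp (‖x‖ ^ 2 / (2 * ħ)) :=
    Real.pow_div_factorial_le_exp _ (by positivity) N
  have hfac : (0 : ℝ) < N.factorial := by exact_mod_cast N.factorial_pos
  have hpow' : (‖x‖ ^ 2) ^ N ≤
      (2 * ħ) ^ N * (N.factorial : ℝ) * Real.exp (‖x‖ ^ 2 / (2 * ħ)) := by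
    rw [div_pow, div_div, div_le_iff₀ (by positivity)] at hpow
    linarith
  rw [norm_pow, norm_norm]
  unfold refStateFun
  rw [norm_mul, norm_mul, norm_pow, Complex.norm_real, Complex.norm_real, ← hK, mul_pow, mul_pow,
    Real.norm_eq_abs, Real.norm_eq_abs, sq_abs, sq_abs]
  have e1 : (‖(x ⟨0, by omega⟩ : ℂ) + Complex.I * (x ⟨1, by omega⟩ : ℂ)‖ ^ N) ^ 2 ≤
      4 ^ N * (‖x‖ ^ 2) ^ N := by
    rw [← pow_mul, mul_comm N 2, pow_mul, ← mul_pow]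
    refine pow_le_pow_left₀ (by positivity) ?_ N
    nlinarith [norm_nonneg ((x ⟨0, by omega⟩ : ℂ) + Complex.I * (x ⟨1, by omega⟩ : ℂ))]
  have e2 : Real.exp (‖x‖ ^ 2 / (2 * ħ)) * Real.exp (-‖x‖ ^ 2 / (2 * ħ)) ^ 2 =
      Real.exp (-(1 / (2 * ħ)) * ‖x‖ ^ 2) := by
    rw [← Real.exp_nat_mul, ← Real.exp_add]
    congr 1
    push_cast
    ring
  calc K ^ 2 * (‖(x ⟨0, by omega⟩ : ℂ) + Complex.I * (x ⟨1, by omega⟩ : ℂ)‖ ^ N) ^ 2 *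
        Real.exp (-‖x‖ ^ 2 / (2 * ħ)) ^ 2
      ≤ K ^ 2 * (4 ^ N * ((2 * ħ) ^ N * (N.factorial : ℝ) * Real.exp (‖x‖ ^ 2 / (2 * ħ)))) *
        Real.exp (-‖x‖ ^ 2 / (2 * ħ)) ^ 2 := by
        gcongr
        exact e1.trans (by gcongr)
    _ = K ^ 2 * (4 ^ N * ((2 * ħ) ^ N * (N.factorial : ℝ))) *
        (Real.exp (‖x‖ ^ 2 / (2 * ħ)) * Real.exp (-‖x‖ ^ 2 / (2 * ħ)) ^ 2) := by ring
    _ = _ := by rw [e2]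

/-- The orbital coherent state `φ_{N,d}^{γ₀}` of the reference orbit, as an element of
`L²(ℝ^d)`. -/
def refState {d : ℕ} (hd : 2 ≤ d) {ħ : ℝ} (hħ : 0 < ħ) (N : ℕ) : StateSpace d :=
  (memLp_refStateFun hd hħ N).toLp

/-- `φ` is an orbital coherent state `φ_{N,d}^γ = μ(U) φ_{N,d}^{γ₀}` centered at the orbit `γ` of
energy `E`, where `U ∈ SU(d)` satisfies `U · γ₀ = γ` (as orbits, that is, up to the choice of the
starting point on the orbit). Such a state is determined up to a phase factor. -/
def IsOrbitalCoherentState {d : ℕ} (hd : 2 ≤ d) (E : ℝ) {ħ : ℝ} (hħ : 0 < ħ) (N : ℕ)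
    (γ : ℝ → Phase d) (φ : StateSpace d) : Prop :=
  ∃ (U : Matrix.specialUnitaryGroup (Fin d) ℂ) (T : StateSpace d ≃ₗᵢ[ℂ] StateSpace d),
    suAct U '' Set.range (refOrbit hd E) = Set.range γ ∧
    IsMetaplectic ħ U T ∧ φ = T (refState hd hħ N)

/-- The Wigner distribution
`W_{f,f}(x, ξ) = (2πħ)^{-d} ∫ f(x + v/2) conj(f(x - v/2)) exp(-(i/ħ)⟨v, ξ⟩) dv`.
For `f` in `L²(ℝ^d)` the integral converges absolutely for every `(x, ξ)`, and does not depend on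
the representative of `f`. -/
def wigner {d : ℕ} (ħ : ℝ) (f : Conf d → ℂ) (z : Phase d) : ℂ :=
  (((2 * Real.pi) ^ d * ħ ^ d)⁻¹ : ℝ) *
    ∫ v : Conf d, f (z.1 + (1 / 2 : ℝ) • v) * (starRingEnd ℂ) (f (z.1 - (1 / 2 : ℝ) • v)) *
      Complex.exp (-Complex.I / ħ * (inner ℝ v z.2 : ℝ))

/-- `|a(x, ξ)| ≤ C exp(-c (|x| + |ξ|))` for some `c > 0` and `C`. -/
def HasExponentialDecay {d : ℕ} (a : Phase d → ℝ) : Prop :=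
  ∃ C c : ℝ, 0 < c ∧ ∀ z, |a z| ≤ C * Real.exp (-c * (‖z.1‖ + ‖z.2‖))

end OrbitalCoherent

end

open OrbitalCoherent

/-! The ambiguity function `w ↦ ⟨φ, ρ(w) φ⟩` determines the Wigner distribution: up to scaling, each
is a Fourier transform of the other. For the reference state it is a Gaussian integral with value
`L_N(|⟨ζ, w⟩|² / 4ħ) exp(-|w|² / 4ħ)`, where `ζ = (1, i, 0, …, 0)` (`inner_weylOp_refState`). A
metaplectic operator only replaces `w` by `U⁻¹ w`, so for a general orbit `ζ` becomes `γ(0) / √E`;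
phases and starting points drop out.

At a fixed frequency the Laguerre argument has order `1/N`, because `ħ (N + d/2) = E`. Hence `L_N`
tends to the Bessel function `J₀` and the Gaussian factor to `1`, and `J₀` is exactly the Fourier
transform of the uniform measure on the circle `exp(-it) γ(0)` (`tendsto_laguerre`,
`IsHamiltonianOrbit.integral_exp`). By Cauchy–Schwarz the characteristic functions are bounded by
`1`, so dominated convergence gives the limit against Schwartz functions
(`tendsto_integral_schwartz`).

The derivatives of `a` are not controlled, so `a` need not be Schwartz. It is cut off, and the
remainder is handled by a pointwise bound on the Wigner function by `ħ^(-d) 8^N exp(-|v|² / 4ħ)` up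
to a constant (`norm_fourierInv_charFn_le`): beyond radius `√(24E)` the Gaussian beats `8^N`, and
the tail is exponentially small in `N`.

For existence, the Weyl translates of the Gaussian `N = 0` state are total, and their Gram kernel
involves only `|w - w'|` and the symplectic form, both preserved by `SU(d)`. So `ρ(w) g ↦ ρ(Uw) g`
extends to a unitary operator (`exists_isMetaplectic`). Transitivity of `SU(d)` on spheres supplies
`U`. -/

namespace OrbitalCoherent

/-! ### Weyl operators -/

section Weyl

variable {d : ℕ} (ħ : ℝ)

theorem weylOp_ae_eq (w : Phase d) (f : StateSpace d) :
    weylOp ħ w f =ᵐ[volume] weylFun ħ w f :=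
  (memLp_weylFun ħ w f).coeFn_toLp

theorem weylFun_congr (w : Phase d) {f g : Conf d → ℂ} (h : f =ᵐ[volume] g) :
    weylFun ħ w f =ᵐ[volume] weylFun ħ w g := by
  have := (measurePreserving_sub_right (volume : Measure (Conf d)) w.1).quasiMeasurePreserving.ae_eq h
  filter_upwards [this] with x hx
  simp only [weylFun, Function.comp_apply] at hx ⊢
  rw [hx]

theorem norm_weylOp (w : Phase d) (f : StateSpace d) : ‖weylOp ħ w f‖ = ‖f‖ := by
  rw [Lp.norm_def, Lp.norm_def]
  congr 1
  rw [eLpNorm_congr_ae (weylOp_ae_eq ħ w f)]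
  have : eLpNorm (weylFun ħ w f) 2 volume = eLpNorm (fun x : Conf d => f (x - w.1)) 2 volume := by
    refine eLpNorm_congr_norm_ae (Eventually.of_forall fun x => ?_)
    simp only [weylFun, norm_mul, Complex.norm_exp_ofReal_mul_I, one_mul]
  rw [this]
  exact eLpNorm_comp_measurePreserving (Lp.aestronglyMeasurable f)
    (measurePreserving_sub_right volume w.1)

/-- The Weyl operator as a linear isometry of `L²(ℝ^d)`. -/
noncomputable def weylIsometry (w : Phase d) : StateSpace d →ₗᵢ[ℂ] StateSpace d where
  toFun := weylOp ħ w
  map_add' f g := by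
    refine Lp.ext ?_
    filter_upwards [weylOp_ae_eq ħ w (f + g), weylOp_ae_eq ħ w f, weylOp_ae_eq ħ w g,
      weylFun_congr ħ w (Lp.coeFn_add f g), Lp.coeFn_add (weylOp ħ w f) (weylOp ħ w g)]
      with x h1 h2 h3 h4 h5
    rw [h1, h4, h5, Pi.add_apply, h2, h3]
    simp [weylFun, mul_add]
  map_smul' c f := by
    refine Lp.ext ?_
    filter_upwards [weylOp_ae_eq ħ w (c • f), weylOp_ae_eq ħ w f,
      weylFun_congr ħ w (Lp.coeFn_smul c f), Lp.coeFn_smul c (weylOp ħ w f)]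
      with x h1 h2 h4 h5
    simp only [RingHom.id_apply]
    rw [h1, h4, h5, Pi.smul_apply, h2]
    simp only [weylFun, Pi.smul_apply, smul_eq_mul]
    ring
  norm_map' := norm_weylOp ħ w

@[simp]
theorem weylIsometry_apply (w : Phase d) (f : StateSpace d) :
    weylIsometry ħ w f = weylOp ħ w f := rfl

theorem weylOp_zero (f : StateSpace d) : weylOp ħ 0 f = f := by
  refine Lp.ext ?_
  filter_upwards [weylOp_ae_eq ħ 0 f] with x h1
  rw [h1]
  simp [weylFun]

/-- The symplectic form `⟨p, q'⟩ - ⟨p', q⟩` of `w = (q, p)` and `w' = (q', p')`. -/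
noncomputable def sympl (w w' : Phase d) : ℝ := inner ℝ w.2 w'.1 - inner ℝ w'.2 w.1

theorem weylOp_weylOp (w w' : Phase d) (f : StateSpace d) :
    weylOp ħ w (weylOp ħ w' f) =
      Complex.exp ((sympl w w' / (2 * ħ) : ℝ) * Complex.I) • weylOp ħ (w + w') f := by
  refine Lp.ext ?_
  filter_upwards [weylOp_ae_eq ħ w (weylOp ħ w' f), weylFun_congr ħ w (weylOp_ae_eq ħ w' f),
    weylOp_ae_eq ħ (w + w') f,
    Lp.coeFn_smul (Complex.exp ((sympl w w' / (2 * ħ) : ℝ) * Complex.I)) (weylOp ħ (w + w') f)]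
    with x h1 h2 h3 h4
  rw [h1, h2, h4, Pi.smul_apply, h3]
  simp only [weylFun, smul_eq_mul, ← mul_assoc, ← Complex.exp_add, Prod.fst_add, Prod.snd_add,
    sub_sub]
  congr 2
  rw [← add_mul, ← add_mul]
  congr 1
  norm_cast
  simp only [sympl, inner_add_left, inner_add_right, inner_sub_right]
  rw [real_inner_comm w.1 w'.2]
  ring

/-- By the Weyl relations, the Gram kernel of a family of Weyl translates is controlled by the
symplectic form and the ambiguity function alone; this reduces the construction of metaplectic
operators to invariance of these two. -/
theorem inner_weylOp_weylOp (w w' : Phase d) (f g : StateSpace d) :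
    inner ℂ (weylOp ħ w f) (weylOp ħ w' g) =
      Complex.exp ((- sympl w w' / (2 * ħ) : ℝ) * Complex.I) * inner ℂ f (weylOp ħ (w' - w) g) := by
  have h : weylOp ħ w (weylOp ħ (w' - w) g) =
      Complex.exp ((sympl w w' / (2 * ħ) : ℝ) * Complex.I) • weylOp ħ w' g := by
    rw [weylOp_weylOp, add_sub_cancel]
    congr 5
    simp only [sympl, Prod.fst_sub, Prod.snd_sub, inner_sub_left, inner_sub_right]
    ring
  rw [← (weylIsometry ħ w).inner_map_map f, weylIsometry_apply, weylIsometry_apply, h,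
    inner_smul_right, ← mul_assoc, ← Complex.exp_add]
  rw [show (((- sympl w w' / (2 * ħ) : ℝ) : ℂ) * Complex.I +
    ((sympl w w' / (2 * ħ) : ℝ) : ℂ) * Complex.I) = 0 by push_cast; ring]
  simp

theorem inner_weylOp_eq_integral (w : Phase d) (f g : StateSpace d) {F G : Conf d → ℂ}
    (hF : f =ᵐ[volume] F) (hG : g =ᵐ[volume] G) :
    inner ℂ f (weylOp ħ w g) = ∫ x, (starRingEnd ℂ) (F x) * weylFun ħ w G x := by
  rw [L2.inner_def]
  refine integral_congr_ae ?_
  filter_upwards [hF, weylOp_ae_eq ħ w g, weylFun_congr ħ w hG] with x h1 h2 h3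
  rw [h1, h2, h3, RCLike.inner_apply']

end Weyl

/-! ### The action of the unitary group -/

section Action

variable {d : ℕ}

/-- The point `x + iξ` of `ℂ^d` corresponding to `(x, ξ)`. -/
def toComplex (z : Phase d) : Fin d → ℂ := fun j => ⟨z.1 j, z.2 j⟩

theorem toComplex_injective : Function.Injective (toComplex (d := d)) := by
  intro z z' h
  refine Prod.ext ?_ ?_ <;> ext j
  · simpa [toComplex] using congrArg Complex.re (congrFun h j)
  · simpa [toComplex] using congrArg Complex.im (congrFun h j)

theorem toComplex_suAct (U : Matrix.specialUnitaryGroup (Fin d) ℂ) (z : Phase d) :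
    toComplex (suAct U z) = (U : Matrix (Fin d) (Fin d) ℂ).mulVec (toComplex z) := by
  ext j
  apply Complex.ext <;> rfl

theorem toComplex_add (z z' : Phase d) : toComplex (z + z') = toComplex z + toComplex z' := by
  ext j
  apply Complex.ext <;> simp [toComplex]

theorem toComplex_sub (z z' : Phase d) : toComplex (z - z') = toComplex z - toComplex z' := by
  ext j
  apply Complex.ext <;> simp [toComplex]

theorem toComplex_smul (c : ℝ) (z : Phase d) : toComplex (c • z) = (c : ℂ) • toComplex z := by
  ext j
  apply Complex.ext <;> simp [toComplex]

/-- The Hermitian product on `ℂ^d`, conjugate linear in the first argument. -/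
noncomputable def herm (v v' : Fin d → ℂ) : ℂ := dotProduct (star v) v'

theorem herm_mulVec (U : Matrix.specialUnitaryGroup (Fin d) ℂ) (v v' : Fin d → ℂ) :
    herm ((U : Matrix (Fin d) (Fin d) ℂ).mulVec v) ((U : Matrix (Fin d) (Fin d) ℂ).mulVec v') =
      herm v v' := by
  have hU : star (U : Matrix (Fin d) (Fin d) ℂ) * U = 1 :=
    Matrix.mem_unitaryGroup_iff'.1 (Matrix.mem_specialUnitaryGroup_iff.1 U.2).1
  rw [herm, Matrix.star_mulVec, Matrix.dotProduct_mulVec, Matrix.vecMul_vecMul,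
    ← Matrix.star_eq_conjTranspose, hU, Matrix.vecMul_one, herm]

/-- Euclidean product and symplectic form are the two parts of one Hermitian product, so unitarity
of `U` yields both `sympl_suAct` and `norm_sq_suAct`. -/
theorem herm_toComplex (w w' : Phase d) :
    herm (toComplex w) (toComplex w') =
      ((inner ℝ w.1 w'.1 + inner ℝ w.2 w'.2 : ℝ) : ℂ) - (sympl w w' : ℝ) * Complex.I := by
  have h : ∀ x y : Conf d, inner ℝ x y = ∑ j, x j * y j := fun x y => by
    simp [PiLp.inner_apply, mul_comm]
  simp only [herm, dotProduct, sympl, h]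
  apply Complex.ext
  · simp [toComplex, Complex.re_sum, Finset.sum_add_distrib]
  · simp [toComplex, Complex.im_sum, Finset.sum_add_distrib, mul_comm]
    ring

theorem sympl_suAct (U : Matrix.specialUnitaryGroup (Fin d) ℂ) (w w' : Phase d) :
    sympl (suAct U w) (suAct U w') = sympl w w' := by
  have h := herm_mulVec U (toComplex w) (toComplex w')
  rw [← toComplex_suAct, ← toComplex_suAct, herm_toComplex, herm_toComplex] at h
  simpa using congrArg Complex.im h

theorem norm_sq_suAct (U : Matrix.specialUnitaryGroup (Fin d) ℂ) (w : Phase d) :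
    ‖(suAct U w).1‖ ^ 2 + ‖(suAct U w).2‖ ^ 2 = ‖w.1‖ ^ 2 + ‖w.2‖ ^ 2 := by
  have h := herm_mulVec U (toComplex w) (toComplex w)
  rw [← toComplex_suAct, herm_toComplex, herm_toComplex] at h
  have := congrArg Complex.re h
  simpa only [Complex.sub_re, Complex.ofReal_re, Complex.re_ofReal_mul, Complex.I_re, mul_zero,
    sub_zero, real_inner_self_eq_norm_sq] using this

theorem suAct_add (U : Matrix.specialUnitaryGroup (Fin d) ℂ) (w w' : Phase d) :
    suAct U (w + w') = suAct U w + suAct U w' := by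
  apply toComplex_injective
  simp only [toComplex_suAct, toComplex_add, Matrix.mulVec_add]

theorem suAct_sub (U : Matrix.specialUnitaryGroup (Fin d) ℂ) (w w' : Phase d) :
    suAct U (w - w') = suAct U w - suAct U w' := by
  apply toComplex_injective
  simp only [toComplex_suAct, toComplex_sub, Matrix.mulVec_sub]

theorem suAct_smul (U : Matrix.specialUnitaryGroup (Fin d) ℂ) (c : ℝ) (w : Phase d) :
    suAct U (c • w) = c • suAct U w := by
  apply toComplex_injective
  simp only [toComplex_suAct, toComplex_smul, Matrix.mulVec_smul]

theorem suAct_mul (U V : Matrix.specialUnitaryGroup (Fin d) ℂ) (w : Phase d) :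
    suAct (U * V) w = suAct U (suAct V w) := by
  apply toComplex_injective
  simp [toComplex_suAct]

theorem suAct_one (w : Phase d) : suAct 1 w = w := by
  apply toComplex_injective
  simp [toComplex_suAct]

/-- The ambiguity function of a state intertwines with metaplectic operators. -/
theorem IsMetaplectic.inner_weylOp {ħ : ℝ} {U : Matrix.specialUnitaryGroup (Fin d) ℂ}
    {T : StateSpace d ≃ₗᵢ[ℂ] StateSpace d} (h : IsMetaplectic ħ U T) (f : StateSpace d)
    (w : Phase d) :
    inner ℂ (T f) (weylOp ħ w (T f)) = inner ℂ f (weylOp ħ (suAct U⁻¹ w) f) := by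
  have h1 := h (suAct U⁻¹ w) f
  rw [← suAct_mul, mul_inv_cancel, suAct_one] at h1
  rw [← h1, T.inner_map_map]

end Action

/-! ### Extraction of Taylor coefficients by circle integrals -/

section Coefficient

/-- The `N`-th Laurent coefficient of `F`, as a Cauchy integral over the unit circle. -/
noncomputable def cauchyCoeff (N : ℕ) (F : ℂ → ℂ) : ℂ :=
  (2 * Real.pi * Complex.I)⁻¹ * ∮ z in C(0, 1), (1 / z ^ (N + 1)) * F z

theorem cauchyCoeff_exp (N : ℕ) (X : ℂ) :
    cauchyCoeff N (fun z => Complex.exp (z * X)) = X ^ N / N.factorial := by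
  have hd : DifferentiableOn ℂ (fun z => Complex.exp (X * z)) (Metric.closedBall 0 1) :=
    (by fun_prop : Differentiable ℂ fun z => Complex.exp (X * z)).differentiableOn
  have h := hd.circleIntegral_one_div_sub_center_pow_smul one_pos N
  simp only [sub_zero, smul_eq_mul, iteratedDeriv_cexp_const_mul, mul_zero, Complex.exp_zero,
    mul_one] at h
  simp only [cauchyCoeff, mul_comm _ X, h]
  have := Complex.two_pi_I_ne_zero
  field_simp

theorem cauchyCoeff_pow_mul_exp {N j : ℕ} (hj : j ≤ N) (X : ℂ) :
    cauchyCoeff N (fun z => z ^ j * Complex.exp (z * X)) = X ^ (N - j) / (N - j).factorial := by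
  rw [← cauchyCoeff_exp, cauchyCoeff, cauchyCoeff]
  congr 1
  refine circleIntegral.integral_congr zero_le_one fun z hz => ?_
  have hz0 : z ≠ 0 := by
    rintro rfl
    simp at hz
  have : z ^ (N + 1) = z ^ (N - j + 1) * z ^ j := by
    rw [← pow_add]
    congr 1
    omega
  simp only [this]
  field_simp

theorem circleIntegrable_inv_pow_mul {F : ℂ → ℂ} (hF : Continuous F) (N : ℕ) :
    CircleIntegrable (fun z => (1 / z ^ (N + 1)) * F z) 0 1 := by
  refine ContinuousOn.circleIntegrable zero_le_one ?_
  refine ContinuousOn.mul (ContinuousOn.div continuousOn_const (by fun_prop) fun z hz => ?_)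
    hF.continuousOn
  refine pow_ne_zero _ ?_
  rintro rfl
  simp at hz

theorem cauchyCoeff_sum {ι : Type*} (s : Finset ι) (N : ℕ) (a : ι → ℂ) {F : ι → ℂ → ℂ}
    (hF : ∀ i, Continuous (F i)) :
    cauchyCoeff N (fun z => ∑ i ∈ s, a i * F i z) = ∑ i ∈ s, a i * cauchyCoeff N (F i) := by
  have h : ∀ z : ℂ, (1 / z ^ (N + 1)) * ∑ i ∈ s, a i * F i z =
      ∑ i ∈ s, (1 / z ^ (N + 1)) * (a i * F i z) := fun z => Finset.mul_sum _ _ _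
  simp only [cauchyCoeff, h]
  rw [circleIntegral.integral_fun_sum fun i _ =>
    circleIntegrable_inv_pow_mul (F := fun z => a i * F i z) (continuous_const.mul (hF i)) N,
    Finset.mul_sum]
  refine Finset.sum_congr rfl fun i _ => ?_
  rw [mul_left_comm (a i), ← circleIntegral.integral_const_mul (a i)]
  congr 1
  refine circleIntegral.integral_congr zero_le_one fun z _ => ?_
  ring

/-- Binomial expansion in `z * κ`: the factor `z ^ (N - k)` leaves the `k`-th Taylor coefficient of
`exp (z * b')`. This is where the Laguerre sum arises. -/
theorem cauchyCoeff_linear_pow_mul_exp (N : ℕ) (κ b b' K : ℂ) :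
    cauchyCoeff N (fun z => K * (b + z * κ) ^ N * Complex.exp (z * b')) =
      K * ∑ k ∈ Finset.range (N + 1), (N.choose k : ℂ) * κ ^ (N - k) * (b * b') ^ k /
        k.factorial := by
  have h : (fun z => K * (b + z * κ) ^ N * Complex.exp (z * b')) = fun z =>
      ∑ k ∈ Finset.range (N + 1), (K * N.choose k * κ ^ (N - k) * b ^ k) *
        (z ^ (N - k) * Complex.exp (z * b')) := by
    ext z
    rw [add_pow, Finset.mul_sum, Finset.sum_mul]
    refine Finset.sum_congr rfl fun k _ => ?_
    rw [mul_pow]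
    ring
  rw [h, cauchyCoeff_sum _ _ _ (fun i => by fun_prop), Finset.mul_sum]
  refine Finset.sum_congr rfl fun k hk => ?_
  have hk : k ≤ N := by simpa [Nat.lt_succ_iff] using hk
  rw [cauchyCoeff_pow_mul_exp (Nat.sub_le N k), Nat.sub_sub_self hk, mul_pow]
  ring

variable {α : Type*} [MeasurableSpace α] {μ : Measure α} [SFinite μ]

/-- Moments are read off from the exponential generating function by Cauchy's formula. Fubini is
legitimate because `|exp (z X)| ≤ exp ‖X‖` on the unit circle. -/
theorem integral_pow_mul {X h : α → ℂ} (hX : AEStronglyMeasurable X μ)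
    (hh : AEStronglyMeasurable h μ)
    (hint : Integrable (fun x => Real.exp ‖X x‖ * ‖h x‖) μ) (N : ℕ) :
    ∫ x, X x ^ N * h x ∂μ =
      N.factorial * cauchyCoeff N (fun z => ∫ x, Complex.exp (z * X x) * h x ∂μ) := by
  have hN : (N.factorial : ℂ) ≠ 0 := by exact_mod_cast N.factorial_ne_zero
  set G : ℝ → α → ℂ := fun θ x => deriv (circleMap 0 1) θ *
    (1 / circleMap 0 1 θ ^ (N + 1) * (Complex.exp (circleMap 0 1 θ * X x) * h x)) with hG
  have hGint : Integrable (Function.uncurry G)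
      ((volume.restrict (Set.uIoc 0 (2 * Real.pi))).prod μ) := by
    have hdom : Integrable (fun z : ℝ × α => (1 : ℝ) * (Real.exp ‖X z.2‖ * ‖h z.2‖))
        ((volume.restrict (Set.uIoc 0 (2 * Real.pi))).prod μ) := by
      refine Integrable.mul_prod (f := fun _ : ℝ => (1 : ℝ)) ?_ hint
      exact integrableOn_const (by simp [Set.uIoc])
    have hc : Continuous (fun θ : ℝ => circleMap 0 1 θ) := continuous_circleMap 0 1
    have hX2 : AEStronglyMeasurable (fun z : ℝ × α => X z.2)
        ((volume.restrict (Set.uIoc 0 (2 * Real.pi))).prod μ) := hX.comp_snd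
    have hh2 : AEStronglyMeasurable (fun z : ℝ × α => h z.2)
        ((volume.restrict (Set.uIoc 0 (2 * Real.pi))).prod μ) := hh.comp_snd
    refine hdom.mono' ?_ (Eventually.of_forall fun z => ?_)
    · simp only [hG, Function.uncurry_def, deriv_circleMap]
      refine AEStronglyMeasurable.mul ?_ (AEStronglyMeasurable.mul ?_
        (AEStronglyMeasurable.mul ?_ hh2))
      · exact (hc.mul continuous_const).aestronglyMeasurable.comp_fst
      · refine Measurable.aestronglyMeasurable ?_
        fun_prop
      · refine Complex.continuous_exp.comp_aestronglyMeasurable ?_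
        exact hc.aestronglyMeasurable.comp_fst.mul hX2
    · have h1 : ‖circleMap 0 1 z.1‖ = 1 := by simp
      simp only [hG, Function.uncurry_def, deriv_circleMap, norm_mul, norm_div, norm_pow, h1,
        Complex.norm_I, norm_one, one_pow, div_one, one_mul]
      gcongr
      rw [Complex.norm_exp]
      refine Real.exp_le_exp.2 ((Complex.re_le_norm _).trans ?_)
      rw [norm_mul, h1, one_mul]
  have hswap := intervalIntegral_integral_swap hGint
  have h1 : (fun x => X x ^ N * h x) = fun x => N.factorial * ((2 * Real.pi * Complex.I)⁻¹ *
      ∫ θ in (0 : ℝ)..2 * Real.pi, G θ x) := by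
    ext x
    have h2 := cauchyCoeff_exp N (X x)
    have h3 : ∫ θ in (0 : ℝ)..2 * Real.pi, G θ x =
        (∮ z in C(0, 1), (1 / z ^ (N + 1)) * Complex.exp (z * X x)) * h x := by
      rw [circleIntegral, ← intervalIntegral.integral_mul_const]
      congr 1
      ext θ
      simp only [hG, smul_eq_mul]
      ring
    rw [h3, ← mul_assoc _ _ (h x)]
    rw [cauchyCoeff] at h2
    rw [h2]
    field_simp
  rw [h1, integral_const_mul, integral_const_mul, ← hswap, cauchyCoeff, circleIntegral]
  congr 3
  ext θ
  simp only [hG, smul_eq_mul]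
  rw [integral_const_mul, integral_const_mul]

/-- Two Cauchy extractions, in `l` and then in `m`, applied to a generating function whose exponent
has no `l²` or `m²` term. -/
theorem integral_pow_mul_pow {X X' h : α → ℂ} (hX : AEStronglyMeasurable X μ)
    (hX' : AEStronglyMeasurable X' μ) (hh : AEStronglyMeasurable h μ)
    (hint : Integrable (fun x => Real.exp (‖X x‖ + ‖X' x‖) * ‖h x‖) μ) {K b b' κ : ℂ}
    (hF : ∀ l m : ℂ, ∫ x, Complex.exp (l * X x + m * X' x) * h x ∂μ =
      K * Complex.exp (l * b + m * b' + l * m * κ)) (N : ℕ) :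
    ∫ x, X x ^ N * X' x ^ N * h x ∂μ = K * N.factorial *
      ∑ k ∈ Finset.range (N + 1), (N.choose k : ℂ) * κ ^ (N - k) * (b * b') ^ k / k.factorial := by
  have hN : (N.factorial : ℂ) ≠ 0 := by exact_mod_cast N.factorial_ne_zero
  -- The circle suffices for the second extraction, and there `hint` dominates `exp (m X')`.
  have step1 : ∀ m ∈ Metric.sphere (0 : ℂ) 1,
      ∫ x, Complex.exp (m * X' x) * (X x ^ N * h x) ∂μ =
        K * (b + m * κ) ^ N * Complex.exp (m * b') := by
    intro m hm
    have hm1 : ‖m‖ = 1 := by simpa using hm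
    have hmeas : AEStronglyMeasurable (fun x => Complex.exp (m * X' x)) μ :=
      Complex.continuous_exp.comp_aestronglyMeasurable (hX'.const_mul m)
    have h1 := integral_pow_mul (X := X) (h := fun x => Complex.exp (m * X' x) * h x) (μ := μ) hX
      (hmeas.mul hh) (hint.mono' ?_ (Eventually.of_forall fun x => ?_)) N
    · have h2 : ∀ z : ℂ, ∫ x, Complex.exp (z * X x) * (Complex.exp (m * X' x) * h x) ∂μ =
          K * Complex.exp (m * b') * Complex.exp (z * (b + m * κ)) := by
        intro z
        have := hF z m
        simp only [Complex.exp_add, mul_assoc] at this ⊢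
        rw [this, ← Complex.exp_add, ← Complex.exp_add, ← Complex.exp_add]
        ring_nf
      have h3 : cauchyCoeff N (fun z => K * Complex.exp (m * b') *
          Complex.exp (z * (b + m * κ))) =
          K * Complex.exp (m * b') * ((b + m * κ) ^ N / N.factorial) := by
        rw [← cauchyCoeff_exp, cauchyCoeff, cauchyCoeff,
          mul_left_comm (K * Complex.exp (m * b')),
          ← circleIntegral.integral_const_mul (K * Complex.exp (m * b'))]
        congr 1
        refine circleIntegral.integral_congr zero_le_one fun z _ => ?_
        ring
      simp only [h2, h3] at h1
      calc _ = ∫ x, X x ^ N * (Complex.exp (m * X' x) * h x) ∂μ := by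
            refine integral_congr_ae (Eventually.of_forall fun x => ?_)
            ring
        _ = _ := by
            rw [h1]
            field_simp
    · exact (Real.continuous_exp.comp_aestronglyMeasurable hX.norm).mul (hmeas.mul hh).norm
    · rw [norm_mul, norm_norm, norm_mul, Real.exp_add, Real.norm_of_nonneg (Real.exp_pos _).le,
        mul_assoc]
      gcongr
      rw [Complex.norm_exp]
      refine Real.exp_le_exp.2 ((Complex.re_le_norm _).trans ?_)
      rw [norm_mul, hm1, one_mul]
  have h1 := integral_pow_mul (X := X') (h := fun x => X x ^ N * h x) (μ := μ) hX'
    ((hX.pow N).mul hh) ((hint.const_mul (N.factorial : ℝ)).mono' ?_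
      (Eventually.of_forall fun x => ?_)) N
  · calc _ = ∫ x, X' x ^ N * (X x ^ N * h x) ∂μ := by
          refine integral_congr_ae (Eventually.of_forall fun x => ?_)
          ring
      _ = N.factorial * cauchyCoeff N (fun z => K * (b + z * κ) ^ N * Complex.exp (z * b')) := by
          rw [h1]
          simp only [cauchyCoeff]
          congr 2
          refine circleIntegral.integral_congr zero_le_one fun z hz => ?_
          simp only [step1 z hz]
      _ = _ := by
          rw [cauchyCoeff_linear_pow_mul_exp]
          ring
  · exact (Real.continuous_exp.comp_aestronglyMeasurable hX'.norm).mul ((hX.pow N).mul hh).norm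
  -- The bound `‖X‖ ^ N ≤ N! exp ‖X‖` lets `hint` dominate the second extraction as well.
  · have := Real.pow_div_factorial_le_exp ‖X x‖ (norm_nonneg _) N
    rw [div_le_iff₀ (by positivity)] at this
    rw [norm_mul, norm_norm, norm_mul, norm_pow, Real.exp_add,
      Real.norm_of_nonneg (Real.exp_pos _).le]
    calc _ ≤ Real.exp ‖X' x‖ * ((Real.exp ‖X x‖ * N.factorial) * ‖h x‖) := by gcongr
      _ = _ := by ring

end Coefficient

/-! ### The ambiguity function of the reference state -/

section Gaussian

variable {d : ℕ}

/-- The exponent on the right is the bilinear square of `c`, without conjugation, so isotropic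
vectors such as `(1, ±i, 0, …)` contribute no square of their own. -/
theorem integral_gaussian_mul_cexp {ħ : ℝ} (hħ : 0 < ħ) (c : Fin d → ℂ) :
    ∫ x : Conf d, Complex.exp (-(‖x‖ ^ 2 / ħ : ℝ) + ∑ j, c j * x j) =
      ((Real.pi * ħ) ^ ((d : ℝ) / 2) : ℝ) * Complex.exp (ħ / 4 * (c ⬝ᵥ c)) := by
  have hb : 0 < ((ħ⁻¹ : ℝ) : ℂ).re := by simpa using hħ
  have hħ' : (ħ : ℂ) ≠ 0 := by exact_mod_cast hħ.ne'
  have h := GaussianFourier.integral_cexp_neg_mul_sum_add hb c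
  rw [← (PiLp.volume_preserving_ofLp (Fin d)).integral_comp
    (MeasurableEquiv.toLp 2 (Fin d → ℝ)).symm.measurableEmbedding] at h
  convert h using 1
  · refine integral_congr_ae (Eventually.of_forall fun x => ?_)
    simp only [EuclideanSpace.norm_sq_eq, Real.norm_eq_abs, sq_abs]
    push_cast
    congr 2
    field_simp
  · congr 1
    · rw [Complex.ofReal_cpow (by positivity)]
      push_cast
      rw [Fintype.card_fin, div_inv_eq_mul]
    · congr 1
      simp only [dotProduct, ← sq]
      push_cast
      field_simp

/-- The null vector `(1, i, 0, …, 0)` spanning the complex line of the reference orbit. -/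
noncomputable def refVec (hd : 2 ≤ d) : Fin d → ℂ :=
  Pi.single ⟨0, by omega⟩ 1 + Pi.single ⟨1, by omega⟩ Complex.I

/-- The Laguerre polynomial `L_N(x) = ∑ₖ C(N, k) (-x)ᵏ / k!`. -/
noncomputable def laguerre (N : ℕ) (x : ℝ) : ℝ :=
  ∑ k ∈ Finset.range (N + 1), (N.choose k : ℝ) * (-x) ^ k / k.factorial

theorem herm_refVec (hd : 2 ≤ d) (v : Fin d → ℂ) :
    herm (refVec hd) v = v ⟨0, by omega⟩ - Complex.I * v ⟨1, by omega⟩ := by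
  rw [herm, refVec, star_add, Pi.star_single, Pi.star_single, add_dotProduct,
    single_dotProduct, single_dotProduct]
  simp
  ring

theorem mul_le_sq_div_add {M ħ : ℝ} (hħ : 0 < ħ) (r : ℝ) :
    M * r ≤ r ^ 2 / (2 * ħ) + M ^ 2 * ħ / 2 := by
  have : r ^ 2 / (2 * ħ) + M ^ 2 * ħ / 2 - M * r = (r - M * ħ) ^ 2 / (2 * ħ) := by
    field_simp
    ring
  have h2 : 0 ≤ (r - M * ħ) ^ 2 / (2 * ħ) := by positivity
  linarith

theorem integrable_exp_neg_mul_norm_sq {V : Type*} [NormedAddCommGroup V] [InnerProductSpace ℝ V]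
    [FiniteDimensional ℝ V] [MeasurableSpace V] [BorelSpace V] {b : ℝ} (hb : 0 < b) :
    Integrable (fun x : V => Real.exp (-b * ‖x‖ ^ 2)) := by
  have h := (GaussianFourier.integrable_cexp_neg_mul_sq_norm_add (V := V)
    (b := (b : ℂ)) (by simpa using hb) 0 0).norm
  refine h.congr (Eventually.of_forall fun x => ?_)
  simp [Complex.norm_exp, ← Complex.ofReal_pow]

theorem norm_coord_add_le (x : Conf d) (i j : Fin d) (c : ℂ) (hc : ‖c‖ = 1) :
    ‖(x i : ℂ) + c * (x j : ℂ)‖ ≤ 2 * ‖x‖ := by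
  refine (norm_add_le _ _).trans ?_
  have h0 := PiLp.norm_apply_le x i
  have h1 := PiLp.norm_apply_le x j
  rw [norm_mul, hc, Complex.norm_real, Complex.norm_real]
  linarith

/-- The Gaussian integral computing the ambiguity function of the reference state. -/
theorem integral_refState_moment (hd : 2 ≤ d) {ħ : ℝ} (hħ : 0 < ħ) (N : ℕ) (w : Phase d) :
    ∫ x : Conf d, ((x ⟨0, by omega⟩ : ℂ) + Complex.I * x ⟨1, by omega⟩ -
        ((w.1 ⟨0, by omega⟩ : ℂ) + Complex.I * w.1 ⟨1, by omega⟩)) ^ N *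
        ((x ⟨0, by omega⟩ : ℂ) + -Complex.I * x ⟨1, by omega⟩) ^ N *
        Complex.exp (-(‖x‖ ^ 2 / ħ : ℝ) + ∑ j, toComplex w j / ħ * x j) =
      ((Real.pi * ħ) ^ ((d : ℝ) / 2) : ℝ) *
        Complex.exp (ħ / 4 * ((fun j => toComplex w j / ħ) ⬝ᵥ (fun j => toComplex w j / ħ))) *
        N.factorial * (ħ ^ N * laguerre N (‖herm (refVec hd) (toComplex w)‖ ^ 2 / (4 * ħ)) : ℝ) := by
  have hħ' : (ħ : ℂ) ≠ 0 := by exact_mod_cast hħ.ne'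
  set i0 : Fin d := ⟨0, by omega⟩ with hi0
  set i1 : Fin d := ⟨1, by omega⟩ with hi1
  have hne : i0 ≠ i1 := by simp [hi0, hi1]
  set R := herm (refVec hd) (toComplex w) with hR
  have hRe : R = toComplex w i0 - Complex.I * toComplex w i1 := herm_refVec hd _
  set c0 : Fin d → ℂ := fun j => toComplex w j / ħ with hc0
  set Q : ℂ := (w.1 i0 : ℂ) + Complex.I * w.1 i1 with hQ
  -- The coefficient of `l` in the exponent is `-Q` from the shift plus `(w₀ + i w₁) / 2` from the
  -- Gaussian integral; this identity turns it into `-conj R / 2`.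
  have hconj : (starRingEnd ℂ) R = 2 * Q - (toComplex w i0 + Complex.I * toComplex w i1) := by
    rw [hRe, hQ]
    apply Complex.ext <;> simp [toComplex] <;> ring
  have hsplit : ∀ (x : Conf d) (l m : ℂ), Complex.exp (l * ((x i0 : ℂ) + Complex.I * x i1 - Q) +
      m * ((x i0 : ℂ) + -Complex.I * x i1)) *
      Complex.exp (-(‖x‖ ^ 2 / ħ : ℝ) + ∑ j, c0 j * x j) = Complex.exp (-(l * Q)) *
      Complex.exp (-(‖x‖ ^ 2 / ħ : ℝ) + ∑ j, (c0 + l • (Pi.single i0 1 + Pi.single i1 Complex.I) +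
        m • (Pi.single i0 1 - Pi.single i1 Complex.I) : Fin d → ℂ) j * x j) := by
    intro x l m
    have hs : ∑ j, (c0 + l • (Pi.single i0 1 + Pi.single i1 Complex.I) +
        m • (Pi.single i0 1 - Pi.single i1 Complex.I) : Fin d → ℂ) j * (x j : ℂ) =
        (c0 + l • (Pi.single i0 1 + Pi.single i1 Complex.I) +
        m • (Pi.single i0 1 - Pi.single i1 Complex.I) : Fin d → ℂ) ⬝ᵥ (fun j => (x j : ℂ)) := rfl
    have hs0 : ∑ j, c0 j * (x j : ℂ) = c0 ⬝ᵥ (fun j => (x j : ℂ)) := rfl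
    rw [hs, hs0, ← Complex.exp_add, ← Complex.exp_add]
    simp only [add_dotProduct, smul_dotProduct, sub_dotProduct, single_dotProduct, smul_eq_mul]
    ring_nf
  have key := integral_pow_mul_pow (α := Conf d) (μ := volume)
    (X := fun x => (x i0 : ℂ) + Complex.I * x i1 - Q)
    (X' := fun x => (x i0 : ℂ) + -Complex.I * x i1)
    (h := fun x => Complex.exp (-(‖x‖ ^ 2 / ħ : ℝ) + ∑ j, c0 j * x j))
    (K := ((Real.pi * ħ) ^ ((d : ℝ) / 2) : ℝ) * Complex.exp (ħ / 4 * (c0 ⬝ᵥ c0)))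
    (b := -(starRingEnd ℂ) R / 2) (b' := R / 2) (κ := ħ)
    (Continuous.aestronglyMeasurable (by fun_prop)) (Continuous.aestronglyMeasurable (by fun_prop))
    (Continuous.aestronglyMeasurable (by fun_prop)) ?_ ?_ N
  · rw [key]
    congr 1
    rw [laguerre, Finset.mul_sum]
    push_cast
    refine Finset.sum_congr rfl fun k hk => ?_
    have hk : k ≤ N := by simpa [Nat.lt_succ_iff] using hk
    -- Here `b * b' = -|R|² / 4`; pulling out one `ħ` per power, next to `κ ^ (N - k) = ħ ^ (N -
    -- k)`, produces `ħ ^ N` and the argument `|R|² / (4ħ)`.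
    have h1 : -(starRingEnd ℂ) R / 2 * (R / 2) = ħ * (-((‖R‖ : ℂ) ^ 2 / (4 * ħ))) := by
      rw [← Complex.ofReal_pow, Complex.sq_norm, Complex.normSq_eq_conj_mul_self]
      field_simp
      ring
    rw [h1, mul_pow]
    obtain ⟨n, rfl⟩ := Nat.exists_eq_add_of_le hk
    rw [Nat.add_sub_cancel_left, pow_add]
    ring
  -- Each of `X`, `X'` grows at most like `2‖x‖`, and the linear term adds `‖w.1‖ / ħ`. Completing
  -- the square absorbs `M‖x‖` into half of the Gaussian.
  · set M : ℝ := 4 + ‖w.1‖ / ħ with hM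
    refine ((integrable_exp_neg_mul_norm_sq (V := Conf d) (b := 1 / (2 * ħ)) (by positivity)).const_mul
      (Real.exp (‖Q‖ + M ^ 2 * ħ / 2))).mono' (Continuous.aestronglyMeasurable (by fun_prop))
      (Eventually.of_forall fun x => ?_)
    rw [norm_mul, norm_norm, Real.norm_of_nonneg (Real.exp_pos _).le, Complex.norm_exp,
      ← Real.exp_add, ← Real.exp_add]
    refine Real.exp_le_exp.2 ?_
    have e1 : (-((‖x‖ ^ 2 / ħ : ℝ) : ℂ) + ∑ j, c0 j * x j).re =
        -(‖x‖ ^ 2 / ħ) + inner ℝ w.1 x / ħ := by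
      rw [Complex.add_re, Complex.neg_re, Complex.ofReal_re, Complex.re_sum, PiLp.inner_apply,
        Finset.sum_div]
      congr 1
      refine Finset.sum_congr rfl fun j _ => ?_
      rw [Complex.re_mul_ofReal, hc0]
      simp only [Complex.div_ofReal_re, toComplex, RCLike.inner_apply, conj_trivial]
      ring
    rw [e1]
    have e2 : inner ℝ w.1 x / ħ ≤ ‖w.1‖ / ħ * ‖x‖ := by
      rw [div_mul_eq_mul_div]
      gcongr
      exact real_inner_le_norm _ _
    have e3 := norm_coord_add_le x i0 i1 Complex.I (by simp)
    have e4 := norm_coord_add_le x i0 i1 (-Complex.I) (by simp)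
    have e5 := norm_sub_le ((x i0 : ℂ) + Complex.I * x i1) Q
    have e6 := mul_le_sq_div_add (M := M) hħ ‖x‖
    have e7 : ‖x‖ ^ 2 / ħ = 2 * (‖x‖ ^ 2 / (2 * ħ)) := by field_simp
    have e8 : 1 / (2 * ħ) * ‖x‖ ^ 2 = ‖x‖ ^ 2 / (2 * ħ) := by ring
    have e9 : M * ‖x‖ = 4 * ‖x‖ + ‖w.1‖ / ħ * ‖x‖ := by rw [hM]; ring
    linarith
  · intro l m
    simp only [hsplit]
    rw [integral_const_mul, integral_gaussian_mul_cexp hħ, mul_left_comm, mul_assoc,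
      ← Complex.exp_add, ← Complex.exp_add]
    congr 2
    -- The vectors `e₀ ± i e₁` are isotropic and have bilinear product `2`: the `l²` and `m²` terms
    -- vanish and the mixed term is `ħ l m`.
    simp only [add_dotProduct, dotProduct_add, smul_dotProduct, dotProduct_smul, sub_dotProduct,
      dotProduct_sub, single_dotProduct, dotProduct_single, smul_eq_mul, Pi.single_eq_same, Pi.add_apply,
      Pi.smul_apply, Pi.sub_apply,
      Pi.single_eq_of_ne hne, Pi.single_eq_of_ne hne.symm]
    have h0 : c0 i0 = toComplex w i0 / ħ := rfl
    have h1 : c0 i1 = toComplex w i1 / ħ := rfl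
    rw [h0, h1, hconj, hRe]
    field_simp
    ring_nf
    simp only [Complex.I_sq]
    ring

/-- Translation and modulation combine into a single complex linear term `(q + ip) / ħ`, so the
integral depends on the phase space point through its image in `ℂ^d`. -/
theorem gaussian_mul_weyl_gaussian {ħ : ℝ} (hħ : 0 < ħ) (w : Phase d) (x : Conf d) :
    (Real.exp (-‖x‖ ^ 2 / (2 * ħ)) : ℂ) * (Complex.exp
      (((inner ℝ w.2 x - inner ℝ w.2 w.1 / 2) / ħ : ℝ) * Complex.I) *
        (Real.exp (-‖x - w.1‖ ^ 2 / (2 * ħ)) : ℂ)) =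
    Complex.exp (-(‖w.1‖ ^ 2 / (2 * ħ) : ℝ) - (inner ℝ w.2 w.1 / (2 * ħ) : ℝ) * Complex.I) *
      Complex.exp (-(‖x‖ ^ 2 / ħ : ℝ) + ∑ j, toComplex w j / ħ * x j) := by
  have hħ' : (ħ : ℂ) ≠ 0 := by exact_mod_cast hħ.ne'
  have h : ∑ j, toComplex w j / ħ * (x j : ℂ) =
      ((inner ℝ w.1 x / ħ : ℝ) : ℂ) + (inner ℝ w.2 x / ħ : ℝ) * Complex.I := by
    simp only [PiLp.inner_apply, RCLike.inner_apply, conj_trivial, Finset.sum_div]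
    push_cast
    rw [Finset.sum_mul, ← Finset.sum_add_distrib]
    refine Finset.sum_congr rfl fun j _ => ?_
    have : toComplex w j = (w.1 j : ℂ) + (w.2 j : ℂ) * Complex.I := by
      apply Complex.ext <;> simp [toComplex]
    rw [this]
    field_simp
  rw [h, norm_sub_sq_real, real_inner_comm w.1 x]
  push_cast
  rw [← Complex.exp_add, ← Complex.exp_add, ← Complex.exp_add]
  congr 1
  field_simp
  ring

/-- The normalization constant of the reference state. -/
noncomputable def refConst (d : ℕ) (ħ : ℝ) (N : ℕ) : ℝ :=
  ((ħ * Real.pi) ^ (((d : ℝ) - 2) / 4) * ħ ^ (((N : ℝ) + 1) / 2) *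
      √(Real.pi * (N.factorial : ℝ)))⁻¹

theorem refStateFun_eq (hd : 2 ≤ d) (ħ : ℝ) (N : ℕ) (x : Conf d) :
    refStateFun hd ħ N x = (refConst d ħ N : ℝ) *
      ((x ⟨0, by omega⟩ : ℂ) + Complex.I * (x ⟨1, by omega⟩ : ℂ)) ^ N *
        (Real.exp (-‖x‖ ^ 2 / (2 * ħ)) : ℝ) := rfl

/-- This is the `L²` normalization: the second factor is the integral of `|x₁ + i x₂|^(2N) exp(-|x|²
/ ħ)`. -/
theorem refConst_sq_mul {ħ : ℝ} (hħ : 0 < ħ) (N : ℕ) :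
    refConst d ħ N ^ 2 * ((Real.pi * ħ) ^ ((d : ℝ) / 2) * (ħ ^ N * N.factorial)) = 1 := by
  have h1 : ((ħ * Real.pi) ^ (((d : ℝ) - 2) / 4)) ^ 2 * (Real.pi * ħ) =
      (Real.pi * ħ) ^ ((d : ℝ) / 2) := by
    have h0 : 0 < Real.pi * ħ := by positivity
    rw [mul_comm ħ, ← Real.rpow_natCast, ← Real.rpow_mul h0.le]
    nth_rewrite 2 [← Real.rpow_one (Real.pi * ħ)]
    rw [← Real.rpow_add h0]
    congr 1
    push_cast
    ring
  have h2 : (ħ ^ (((N : ℝ) + 1) / 2)) ^ 2 = ħ ^ N * ħ := by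
    rw [← Real.rpow_natCast, ← Real.rpow_mul hħ.le, ← pow_succ, ← Real.rpow_natCast]
    congr 1
    push_cast
    ring
  have h3 : (√(Real.pi * (N.factorial : ℝ))) ^ 2 = Real.pi * N.factorial :=
    Real.sq_sqrt (by positivity)
  rw [refConst, inv_pow, mul_pow, mul_pow, h2, h3, ← h1]
  have h4 : 0 < (ħ * Real.pi) ^ (((d : ℝ) - 2) / 4) := by positivity
  have h5 : (0 : ℝ) < N.factorial := by positivity
  field_simp

theorem herm_self_toComplex (w : Phase d) :
    herm (toComplex w) (toComplex w) = ((‖w.1‖ ^ 2 + ‖w.2‖ ^ 2 : ℝ) : ℂ) := by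
  rw [herm_toComplex]
  simp [sympl]

theorem dotProduct_self_toComplex (w : Phase d) :
    toComplex w ⬝ᵥ toComplex w =
      ((‖w.1‖ ^ 2 - ‖w.2‖ ^ 2 : ℝ) : ℂ) + (2 * inner ℝ w.2 w.1 : ℝ) * Complex.I := by
  simp only [dotProduct, EuclideanSpace.norm_sq_eq, PiLp.inner_apply, Real.norm_eq_abs, sq_abs,
    RCLike.inner_apply, conj_trivial, ← Finset.sum_sub_distrib]
  apply Complex.ext
  · simp [toComplex, Complex.re_sum, pow_two, -Complex.ofReal_sum]
  · simp [toComplex, Complex.im_sum, Finset.mul_sum, two_mul, mul_comm, -Complex.ofReal_sum]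

/-- The ambiguity function of the reference state is a Laguerre function. -/
theorem inner_weylOp_refState (hd : 2 ≤ d) {ħ : ℝ} (hħ : 0 < ħ) (N : ℕ) (w : Phase d) :
    inner ℂ (refState hd hħ N) (weylOp ħ w (refState hd hħ N)) =
      ((laguerre N (‖herm (refVec hd) (toComplex w)‖ ^ 2 / (4 * ħ)) *
        Real.exp (-(‖w.1‖ ^ 2 + ‖w.2‖ ^ 2) / (4 * ħ)) : ℝ) : ℂ) := by
  have hae : refState hd hħ N =ᵐ[volume] refStateFun hd ħ N :=
    (memLp_refStateFun hd hħ N).coeFn_toLp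
  have hħ' : (ħ : ℂ) ≠ 0 := by exact_mod_cast hħ.ne'
  rw [inner_weylOp_eq_integral ħ w _ _ hae hae]
  have h1 : ∀ x : Conf d, (starRingEnd ℂ) (refStateFun hd ħ N x) *
      weylFun ħ w (refStateFun hd ħ N) x = ((refConst d ħ N ^ 2 : ℝ) : ℂ) *
      Complex.exp (-(‖w.1‖ ^ 2 / (2 * ħ) : ℝ) - (inner ℝ w.2 w.1 / (2 * ħ) : ℝ) * Complex.I) *
      (((x ⟨0, by omega⟩ : ℂ) + Complex.I * x ⟨1, by omega⟩ -
        ((w.1 ⟨0, by omega⟩ : ℂ) + Complex.I * w.1 ⟨1, by omega⟩)) ^ N *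
        ((x ⟨0, by omega⟩ : ℂ) + -Complex.I * x ⟨1, by omega⟩) ^ N *
        Complex.exp (-(‖x‖ ^ 2 / ħ : ℝ) + ∑ j, toComplex w j / ħ * x j)) := by
    intro x
    have := gaussian_mul_weyl_gaussian hħ w x
    simp only [refStateFun_eq, weylFun, map_mul, Complex.conj_ofReal, map_pow, map_add,
      Complex.conj_I, PiLp.sub_apply, Complex.ofReal_sub]
    calc _ = ((refConst d ħ N ^ 2 : ℝ) : ℂ) * (((x ⟨0, by omega⟩ : ℂ) +
          Complex.I * x ⟨1, by omega⟩ -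
          ((w.1 ⟨0, by omega⟩ : ℂ) + Complex.I * w.1 ⟨1, by omega⟩)) ^ N *
          ((x ⟨0, by omega⟩ : ℂ) + -Complex.I * x ⟨1, by omega⟩) ^ N) *
          ((Real.exp (-‖x‖ ^ 2 / (2 * ħ)) : ℂ) * (Complex.exp
          (((inner ℝ w.2 x - inner ℝ w.2 w.1 / 2) / ħ : ℝ) * Complex.I) *
          (Real.exp (-‖x - w.1‖ ^ 2 / (2 * ħ)) : ℂ))) := by
          push_cast
          ring
      _ = _ := by
          rw [this]
          push_cast
          ring
  simp only [h1]
  rw [integral_const_mul, integral_refState_moment hd hħ N w]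
  -- The symmetric phase `-⟨p, q⟩ / 2` in the Weyl operator cancels the imaginary part of the
  -- bilinear square of `q + ip`, so the ambiguity function is real.
  have h2 : Complex.exp (-(‖w.1‖ ^ 2 / (2 * ħ) : ℝ) -
      (inner ℝ w.2 w.1 / (2 * ħ) : ℝ) * Complex.I) * Complex.exp (ħ / 4 *
        ((fun j => toComplex w j / ħ) ⬝ᵥ (fun j => toComplex w j / ħ))) =
      ((Real.exp (-(‖w.1‖ ^ 2 + ‖w.2‖ ^ 2) / (4 * ħ)) : ℝ) : ℂ) := by
    have h3 : ((fun j => toComplex w j / ħ) ⬝ᵥ (fun j => toComplex w j / ħ)) =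
        (toComplex w ⬝ᵥ toComplex w) / ħ ^ 2 := by
      simp only [dotProduct, Finset.sum_div]
      refine Finset.sum_congr rfl fun j _ => ?_
      field_simp
    rw [h3, dotProduct_self_toComplex, ← Complex.exp_add]
    push_cast
    congr 1
    field_simp
    ring
  have h4 := refConst_sq_mul (d := d) hħ N
  have h4' : ((refConst d ħ N ^ 2 : ℝ) : ℂ) * (((Real.pi * ħ) ^ ((d : ℝ) / 2) : ℝ) *
      ((ħ : ℂ) ^ N * N.factorial)) = 1 := by exact_mod_cast h4
  rw [Complex.ofReal_mul (laguerre _ _), ← h2]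
  rw [Complex.ofReal_mul]
  push_cast at h4' ⊢
  linear_combination (laguerre N (‖herm (refVec hd) (toComplex w)‖ ^ 2 / (4 * ħ)) *
    Complex.exp (-(‖w.1‖ ^ 2 / (2 * ħ)) -
      (inner ℝ w.2 w.1 / (2 * ħ)) * Complex.I) * Complex.exp (ħ / 4 *
        ((fun j => toComplex w j / ħ) ⬝ᵥ (fun j => toComplex w j / ħ)))) * h4'

end Gaussian

/-! ### Almost everywhere Fourier inversion for integrable functions -/

section FourierL1

open scoped FourierTransform SchwartzMap

variable {V : Type*} [NormedAddCommGroup V] [InnerProductSpace ℝ V] [FiniteDimensional ℝ V]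
  [MeasurableSpace V] [BorelSpace V]

theorem continuous_fourier {f : V → ℂ} (hf : Integrable f) : Continuous (𝓕 f) :=
  VectorFourier.fourierIntegral_continuous Real.continuous_fourierChar
    (innerSL ℝ).continuous₂ hf

theorem continuous_fourierInv {f : V → ℂ} (hf : Integrable f) : Continuous (𝓕⁻ f) := by
  have h : (𝓕⁻ f) = fun v => 𝓕 f (-v) := by
    ext v
    exact Real.fourierInv_eq_fourier_neg f v
  rw [h]
  exact (continuous_fourier hf).comp continuous_neg

theorem integral_fourier_mul_eq {f g : V → ℂ} (hf : Integrable f) (hg : Integrable g) :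
    ∫ v, 𝓕 f v * g v = ∫ v, f v * 𝓕 g v := by
  have h := VectorFourier.integral_fourierIntegral_smul_eq_flip (L := innerₗ V) (μ := volume)
    (ν := volume) Real.continuous_fourierChar (innerSL ℝ).continuous₂ hf hg
  rw [flip_innerₗ] at h
  exact h

theorem integral_fourierInv_mul_eq {f g : V → ℂ} (hf : Integrable f) (hg : Integrable g) :
    ∫ v, 𝓕⁻ f v * g v = ∫ v, f v * 𝓕⁻ g v := by
  have h := integral_fourier_mul_eq hf.comp_neg hg
  rw [← Real.fourierInv_eq_fourier_comp_neg] at h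
  rw [h, ← integral_neg_eq_self]
  simp [Real.fourierInv_eq_fourier_neg]

/-- Tested against a smooth compactly supported `g`, both transforms can be moved onto `g`, where
Schwartz inversion applies. No continuity of `f` is assumed, as needed for correlations of `L²`
functions. -/
theorem ae_eq_fourierInv_fourier {f : V → ℂ} (hf : Integrable f) (hf' : Integrable (𝓕 f)) :
    f =ᵐ[volume] 𝓕⁻ (𝓕 f) := by
  refine ae_eq_of_integral_contDiff_smul_eq hf.locallyIntegrable
    (continuous_fourierInv hf').locallyIntegrable fun g hg hgc => ?_
  have hGc : HasCompactSupport (fun v => (g v : ℂ)) :=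
    hgc.comp_left (g := Complex.ofReal) Complex.ofReal_zero
  have hGd : ContDiff ℝ ∞ (fun v => (g v : ℂ)) := Complex.ofRealCLM.contDiff.comp hg
  set G : 𝓢(V, ℂ) := hGc.toSchwartzMap hGd with hG
  have hGg : ∀ v, G v = g v := fun v => rfl
  have h1 : ∫ v, f v * (𝓕 (𝓕⁻ G)) v = ∫ v, 𝓕 f v * (𝓕⁻ G) v :=
    (integral_fourier_mul_eq hf (𝓕⁻ G).integrable).symm
  have h2 : ∫ v, 𝓕 f v * (𝓕⁻ G) v = ∫ v, 𝓕⁻ (𝓕 f) v * G v := by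
    rw [integral_fourierInv_mul_eq hf' G.integrable, SchwartzMap.fourierInv_coe]
  rw [FourierTransform.fourier_fourierInv_eq, h2] at h1
  simpa only [Complex.real_smul, hGg, mul_comm] using h1

theorem ae_eq_zero_of_fourier_eq_zero {f : V → ℂ} (hf : Integrable f) (h : ∀ v, 𝓕 f v = 0) :
    f =ᵐ[volume] 0 := by
  have h0 : 𝓕 f = 0 := funext h
  have := ae_eq_fourierInv_fourier hf (by rw [h0]; exact integrable_zero _ _ _)
  rw [h0] at this
  filter_upwards [this] with x hx
  rw [hx, Real.fourierInv_eq]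
  simp

end FourierL1

/-! ### Existence of metaplectic operators -/

section Metaplectic

open scoped FourierTransform

variable {d : ℕ}

/-- Momentum translations already suffice: if `f` is orthogonal to all of them, the Fourier
transform of `conj f` times the Gaussian vanishes, and the Gaussian has no zeros. -/
theorem span_weylOp_dense (hd : 2 ≤ d) {ħ : ℝ} (hħ : 0 < ħ) :
    (Submodule.span ℂ (Set.range fun w => weylOp ħ w (refState hd hħ 0))).topologicalClosure
      = ⊤ := by
  rw [Submodule.topologicalClosure_eq_top_iff, Submodule.eq_bot_iff]
  intro f hf
  rw [Submodule.mem_orthogonal'] at hf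
  have hf0 : ∀ w, inner ℂ f (weylOp ħ w (refState hd hħ 0)) = 0 := fun w =>
    hf _ (Submodule.subset_span ⟨w, rfl⟩)
  have hae : refState hd hħ 0 =ᵐ[volume] refStateFun hd ħ 0 :=
    (memLp_refStateFun hd hħ 0).coeFn_toLp
  set k : Conf d → ℂ := fun x => (starRingEnd ℂ) (f x) * refStateFun hd ħ 0 x with hk
  have hkint : Integrable k := by
    have h1 : MemLp (fun x => (starRingEnd ℂ) (f x)) 2 volume := (Lp.memLp f).star
    exact h1.integrable_mul (memLp_refStateFun hd hħ 0)
  have hkF : ∀ s, 𝓕 k s = 0 := by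
    intro s
    have h2 := hf0 (0, -(2 * Real.pi * ħ) • s)
    rw [inner_weylOp_eq_integral ħ _ f _ (EventuallyEq.refl _ _) hae] at h2
    rw [Real.fourier_eq', ← h2]
    refine integral_congr_ae (Eventually.of_forall fun x => ?_)
    simp only [hk, weylFun, smul_eq_mul, inner_zero_right, sub_zero, zero_div, inner_smul_left,
      conj_trivial, real_inner_comm s x]
    rw [mul_left_comm]
    congr 4
    push_cast
    have : (ħ : ℂ) ≠ 0 := by exact_mod_cast hħ.ne'
    field_simp
  have hk0 := ae_eq_zero_of_fourier_eq_zero hkint hkF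
  refine Lp.ext ?_
  filter_upwards [hk0, Lp.coeFn_zero ℂ 2 (volume : Measure (Conf d))] with x hx h0
  rw [h0]
  have hne : refStateFun hd ħ 0 x ≠ 0 := by
    rw [refStateFun_eq, pow_zero, mul_one]
    have hc : refConst d ħ 0 ≠ 0 := by
      intro hc
      have := refConst_sq_mul (d := d) hħ 0
      simp [hc] at this
    exact mul_ne_zero (by exact_mod_cast hc) (by exact_mod_cast (Real.exp_pos _).ne')
  simpa [hk, hne] using hx

/-- As `L₀ = 1`, the vacuum ambiguity function is a radial Gaussian, so every ingredient of the Gram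
kernel is `SU(d)`-invariant. -/
theorem inner_weylOp_vacuum (hd : 2 ≤ d) {ħ : ℝ} (hħ : 0 < ħ) (w w' : Phase d)
    (U : Matrix.specialUnitaryGroup (Fin d) ℂ) :
    inner ℂ (weylOp ħ (suAct U w) (refState hd hħ 0)) (weylOp ħ (suAct U w') (refState hd hħ 0)) =
      inner ℂ (weylOp ħ w (refState hd hħ 0)) (weylOp ħ w' (refState hd hħ 0)) := by
  simp only [inner_weylOp_weylOp, ← suAct_sub, sympl_suAct, inner_weylOp_refState, norm_sq_suAct,
    laguerre]
  simp

/-- Every element of `SU(d)` has a metaplectic operator. -/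
theorem exists_isMetaplectic (hd : 2 ≤ d) {ħ : ℝ} (hħ : 0 < ħ)
    (U : Matrix.specialUnitaryGroup (Fin d) ℂ) :
    ∃ T : StateSpace d ≃ₗᵢ[ℂ] StateSpace d, IsMetaplectic ħ U T := by
  set g := refState hd hħ 0 with hg
  set e₁ : (Phase d →₀ ℂ) →ₗ[ℂ] StateSpace d :=
    Finsupp.linearCombination ℂ (fun w => weylOp ħ w g) with he₁
  set e₂ : (Phase d →₀ ℂ) →ₗ[ℂ] StateSpace d :=
    Finsupp.linearCombination ℂ (fun w => weylOp ħ (suAct U w) g) with he₂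
  have hdense : ∀ v : Phase d → StateSpace d, Set.range v = Set.range (fun w => weylOp ħ w g) →
      DenseRange (Finsupp.linearCombination ℂ v) := by
    intro v hv
    have h := span_weylOp_dense hd hħ
    rw [← hg, ← hv, ← Finsupp.range_linearCombination] at h
    rw [DenseRange, dense_iff_closure_eq]
    have h2 := congrArg (fun S : Submodule ℂ (StateSpace d) => (S : Set (StateSpace d))) h
    simpa only [Submodule.topologicalClosure_coe, LinearMap.coe_range, Submodule.top_coe] using h2
  have hd₁ : DenseRange e₁ := hdense _ rfl
  have hd₂ : DenseRange e₂ := by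
    refine hdense _ ?_
    have hs : Function.Surjective (suAct U) := fun w => ⟨suAct U⁻¹ w, by
      rw [← suAct_mul, mul_inv_cancel, suAct_one]⟩
    exact hs.range_comp (fun w => weylOp ħ w g)
  -- Equal Gram kernels give equal norms of finite combinations, so `e₁ x ↦ e₂ x` is well defined
  -- and isometric on a dense subspace.
  have hnorm : ∀ x, ‖e₂ x‖ = ‖e₁ x‖ := by
    intro x
    have h : inner ℂ (e₂ x) (e₂ x) = inner ℂ (e₁ x) (e₁ x) := by
      simp only [he₁, he₂, Finsupp.linearCombination_apply, Finsupp.sum, sum_inner, inner_sum,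
        inner_smul_left, inner_smul_right]
      simp only [hg, inner_weylOp_vacuum]
    rw [inner_self_eq_norm_sq_to_K, inner_self_eq_norm_sq_to_K] at h
    have h' : ‖e₂ x‖ ^ 2 = ‖e₁ x‖ ^ 2 := by exact_mod_cast h
    exact (sq_eq_sq₀ (norm_nonneg _) (norm_nonneg _)).1 h'
  set T := (LinearEquiv.refl ℂ (Phase d →₀ ℂ)).extendOfIsometry e₁ e₂ hd₁ hd₂ hnorm with hT
  have hTe : ∀ x, T (e₁ x) = e₂ x := fun x =>
    LinearEquiv.extendOfIsometry_eq (LinearEquiv.refl ℂ (Phase d →₀ ℂ)) e₁ e₂ hd₁ hd₂ hnorm x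
  have hTw : ∀ w, T (weylOp ħ w g) = weylOp ħ (suAct U w) g := by
    intro w
    have := hTe (Finsupp.single w 1)
    simpa [he₁, he₂] using this
  refine ⟨T, fun w f => ?_⟩
  have hcont : ∀ w : Phase d, Continuous (weylOp ħ w : StateSpace d → StateSpace d) := fun w =>
    (weylIsometry ħ w).continuous
  -- By density the intertwining relation need only hold on the translates of `g`, where it follows
  -- from the Weyl relations and `sympl_suAct`.
  refine hd₁.induction_on (p := fun f => T (weylOp ħ w f) = weylOp ħ (suAct U w) (T f)) f
    (isClosed_eq (T.continuous.comp (hcont w)) ((hcont _).comp T.continuous)) fun x => ?_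
  have hlin : (T.toLinearEquiv.toLinearMap ∘ₗ (weylIsometry ħ w).toLinearMap) ∘ₗ e₁ =
      ((weylIsometry ħ (suAct U w)).toLinearMap ∘ₗ T.toLinearEquiv.toLinearMap) ∘ₗ e₁ := by
    refine Finsupp.lhom_ext' fun w' => LinearMap.ext_ring ?_
    simp [he₁, weylOp_weylOp, hTw, ← suAct_add, sympl_suAct]
  exact LinearMap.congr_fun hlin x

end Metaplectic

/-! ### Orbits of the harmonic oscillator -/

section Orbits

variable {d : ℕ}

/-- The orbit rotated back by the angle `t` has zero derivative, hence is constant. -/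
theorem IsHamiltonianOrbit.eq {γ : ℝ → Phase d} (hγ : IsHamiltonianOrbit γ) (t : ℝ) :
    γ t = (Real.cos t • (γ 0).1 + Real.sin t • (γ 0).2,
      -Real.sin t • (γ 0).1 + Real.cos t • (γ 0).2) := by
  have h1 : ∀ s, HasDerivAt (fun s => Real.cos s • (γ s).1 - Real.sin s • (γ s).2) 0 s := by
    intro s
    have := ((Real.hasDerivAt_cos s).smul (hγ s).1).sub ((Real.hasDerivAt_sin s).smul (hγ s).2)
    refine this.congr_deriv ?_
    module
  have h2 : ∀ s, HasDerivAt (fun s => Real.sin s • (γ s).1 + Real.cos s • (γ s).2) 0 s := by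
    intro s
    have := ((Real.hasDerivAt_sin s).smul (hγ s).1).add ((Real.hasDerivAt_cos s).smul (hγ s).2)
    refine this.congr_deriv ?_
    module
  have e1 := is_const_of_deriv_eq_zero (fun s => (h1 s).differentiableAt)
    (fun s => (h1 s).deriv) t 0
  have e2 := is_const_of_deriv_eq_zero (fun s => (h2 s).differentiableAt)
    (fun s => (h2 s).deriv) t 0
  simp only [Real.cos_zero, Real.sin_zero, one_smul, zero_smul, sub_zero, zero_add] at e1 e2
  rw [← e1, ← e2]
  have hc := Real.cos_sq_add_sin_sq t
  refine Prod.ext ?_ ?_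
  · have : (γ t).1 = (Real.cos t ^ 2 + Real.sin t ^ 2) • (γ t).1 := by rw [hc, one_smul]
    nth_rewrite 1 [this]
    module
  · have : (γ t).2 = (Real.cos t ^ 2 + Real.sin t ^ 2) • (γ t).2 := by rw [hc, one_smul]
    nth_rewrite 1 [this]
    module

theorem exp_neg_mul_I_eq (t : ℝ) :
    Complex.exp (-(t * Complex.I)) = (Real.cos t : ℂ) - Real.sin t * Complex.I := by
  rw [← neg_mul, Complex.exp_mul_I, Complex.cos_neg, Complex.sin_neg, Complex.ofReal_cos,
    Complex.ofReal_sin]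
  ring

theorem IsHamiltonianOrbit.toComplex_eq {γ : ℝ → Phase d} (hγ : IsHamiltonianOrbit γ) (t : ℝ) :
    toComplex (γ t) = Complex.exp (-(t * Complex.I)) • toComplex (γ 0) := by
  rw [hγ.eq t, exp_neg_mul_I_eq]
  ext j
  apply Complex.ext <;> simp [toComplex, -Complex.ofReal_cos, -Complex.ofReal_sin]
  ring

theorem toComplex_refOrbit (hd : 2 ≤ d) (E t : ℝ) :
    toComplex (refOrbit hd E t) = (√E * Complex.exp (-(t * Complex.I))) • refVec hd := by
  rw [exp_neg_mul_I_eq]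
  ext j
  have hne : (⟨0, by omega⟩ : Fin d) ≠ ⟨1, by omega⟩ := by simp
  by_cases h0 : j = ⟨0, by omega⟩
  · subst h0
    apply Complex.ext <;>
      simp [toComplex, refOrbit, refVec, -Complex.ofReal_cos, -Complex.ofReal_sin]
  · by_cases h1 : j = ⟨1, by omega⟩
    · subst h1
      apply Complex.ext <;>
        simp [toComplex, refOrbit, refVec, -Complex.ofReal_cos, -Complex.ofReal_sin]
    · apply Complex.ext <;> simp [toComplex, refOrbit, refVec, h0, h1]

theorem herm_self (v : Fin d → ℂ) : herm v v = ((‖WithLp.toLp 2 v‖ ^ 2 : ℝ) : ℂ) := by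
  rw [EuclideanSpace.norm_sq_eq, herm, dotProduct]
  push_cast
  refine Finset.sum_congr rfl fun j _ => ?_
  rw [Pi.star_apply, RCLike.star_def, Complex.conj_mul']

theorem herm_refVec_self (hd : 2 ≤ d) : herm (refVec hd) (refVec hd) = 2 := by
  rw [herm_refVec]
  simp [refVec]
  norm_num

/-- Extend `v` to an orthonormal basis and take its vectors as columns. -/
theorem exists_unitary_mulVec_single (i : Fin d) {v : Fin d → ℂ} (hv : herm v v = 1) :
    ∃ M ∈ Matrix.unitaryGroup (Fin d) ℂ, M.mulVec (Pi.single i 1) = v := by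
  set v' : EuclideanSpace ℂ (Fin d) := WithLp.toLp 2 v with hv'
  have hn : ‖v'‖ = 1 := by
    rw [herm_self] at hv
    have : ‖v'‖ ^ 2 = 1 := by exact_mod_cast hv
    rwa [pow_eq_one_iff_of_nonneg (norm_nonneg _) two_ne_zero] at this
  have ho : Orthonormal ℂ (({i} : Set (Fin d)).domRestrict fun _ => v') := by
    refine ⟨fun _ => hn, fun a b hab => ?_⟩
    exact absurd (Subsingleton.elim a b) hab
  obtain ⟨b, hb⟩ := ho.exists_orthonormalBasis_extension_of_card_eq (by simp)
  refine ⟨Matrix.of fun k j => b j k, ?_, ?_⟩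
  · rw [Matrix.mem_unitaryGroup_iff']
    ext k j
    rw [Matrix.mul_apply, Matrix.one_apply]
    have := orthonormal_iff_ite.1 b.orthonormal k j
    rw [← this, PiLp.inner_apply]
    refine Finset.sum_congr rfl fun l _ => ?_
    simp [Matrix.star_apply, mul_comm]
  · ext k
    simp [Matrix.mulVec_single, hb i rfl, hv']

/-- The determinant is corrected by a phase on the second column, which leaves the image of the
first basis vector alone; this needs `2 ≤ d`. -/
theorem exists_specialUnitary_mulVec_single (hd : 2 ≤ d) {v : Fin d → ℂ} (hv : herm v v = 1) :
    ∃ M : Matrix.specialUnitaryGroup (Fin d) ℂ,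
      (M : Matrix (Fin d) (Fin d) ℂ).mulVec (Pi.single ⟨0, by omega⟩ 1) = v := by
  obtain ⟨M, hM, hMv⟩ := exists_unitary_mulVec_single ⟨0, by omega⟩ hv
  have hne : (⟨0, by omega⟩ : Fin d) ≠ ⟨1, by omega⟩ := by simp
  set D : Matrix (Fin d) (Fin d) ℂ :=
    Matrix.diagonal (Function.update 1 ⟨1, by omega⟩ (star M.det)) with hD
  have hdet : star M.det * M.det = 1 := by
    have := Matrix.det_of_mem_unitary hM
    exact (Unitary.mem_iff.1 this).1
  have hDu : D ∈ Matrix.unitaryGroup (Fin d) ℂ := by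
    rw [Matrix.mem_unitaryGroup_iff, hD, Matrix.star_eq_conjTranspose,
      Matrix.diagonal_conjTranspose, Matrix.diagonal_mul_diagonal, ← Matrix.diagonal_one]
    congr 1
    ext j
    by_cases hj : j = ⟨1, by omega⟩
    · subst hj
      simpa using hdet
    · simp [Function.update_of_ne hj]
  refine ⟨⟨M * D, Matrix.mem_specialUnitaryGroup_iff.2 ⟨mul_mem hM hDu, ?_⟩⟩, ?_⟩
  · rw [Matrix.det_mul, hD, Matrix.det_diagonal, Finset.prod_update_of_mem (Finset.mem_univ _)]
    simpa [mul_comm] using hdet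
  · change (M * D).mulVec _ = v
    rw [← Matrix.mulVec_mulVec, hD, Matrix.diagonal_mulVec_single, Function.update_of_ne hne]
    simpa using hMv

theorem herm_smul_smul (a b : ℂ) (v v' : Fin d → ℂ) :
    herm (a • v) (b • v') = star a * b * herm v v' := by
  simp only [herm, star_smul, smul_dotProduct, dotProduct_smul, smul_eq_mul]
  ring

/-- `SU(d)` acts transitively on spheres of `ℂ^d`. -/
theorem exists_specialUnitary_mulVec (hd : 2 ≤ d) {v v' : Fin d → ℂ} {r : ℝ} (hr : 0 < r)
    (hv : herm v v = r) (hv' : herm v' v' = r) :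
    ∃ U : Matrix.specialUnitaryGroup (Fin d) ℂ,
      (U : Matrix (Fin d) (Fin d) ℂ).mulVec v = v' := by
  have hc : ∀ x : Fin d → ℂ, herm x x = r →
      herm (((√r)⁻¹ : ℂ) • x) (((√r)⁻¹ : ℂ) • x) = 1 := by
    intro x hx
    have h2 : ((√r : ℝ) : ℂ) ≠ 0 := by exact_mod_cast (Real.sqrt_pos.2 hr).ne'
    have h3 : (r : ℂ) = (√r : ℝ) * (√r : ℝ) := by exact_mod_cast (Real.mul_self_sqrt hr.le).symm
    rw [herm_smul_smul, hx]
    simp only [star_inv₀, RCLike.star_def, Complex.conj_ofReal]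
    rw [h3]
    field_simp
  obtain ⟨M, hM⟩ := exists_specialUnitary_mulVec_single hd (hc v hv)
  obtain ⟨M', hM'⟩ := exists_specialUnitary_mulVec_single hd (hc v' hv')
  have hr' : ((√r : ℝ) : ℂ) ≠ 0 := by exact_mod_cast (Real.sqrt_pos.2 hr).ne'
  have key : ((M' * M⁻¹ : Matrix.specialUnitaryGroup (Fin d) ℂ) :
      Matrix (Fin d) (Fin d) ℂ).mulVec (((√r)⁻¹ : ℂ) • v) = ((√r)⁻¹ : ℂ) • v' := by
    rw [← hM, Matrix.mulVec_mulVec, ← Submonoid.coe_mul, inv_mul_cancel_right, hM']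
  refine ⟨M' * M⁻¹, ?_⟩
  rw [Matrix.mulVec_smul] at key
  exact smul_right_injective _ (inv_ne_zero hr') key

/-- The flow is multiplication by `exp(-it)`, which commutes with complex linear maps, so it is
enough to match the points at `t = 0`; both have squared norm `2E`. -/
theorem exists_suAct_refOrbit (hd : 2 ≤ d) {E : ℝ} (hE : 0 < E) {γ : ℝ → Phase d}
    (hγ : IsHamiltonianOrbit γ) (hγE : energy (γ 0) = E) :
    ∃ U : Matrix.specialUnitaryGroup (Fin d) ℂ, ∀ t, suAct U (refOrbit hd E t) = γ t := by
  have h1 : herm ((√E : ℂ) • refVec hd) ((√E : ℂ) • refVec hd) = (2 * E : ℝ) := by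
    rw [herm_smul_smul, herm_refVec_self]
    simp only [RCLike.star_def, Complex.conj_ofReal]
    rw [← Complex.ofReal_mul, Real.mul_self_sqrt hE.le]
    push_cast
    ring
  have h2 : herm (toComplex (γ 0)) (toComplex (γ 0)) = (2 * E : ℝ) := by
    rw [herm_self_toComplex, ← hγE, energy]
    congr 1
    ring
  obtain ⟨U, hU⟩ := exists_specialUnitary_mulVec hd (by positivity) h1 h2
  refine ⟨U, fun t => toComplex_injective ?_⟩
  rw [toComplex_suAct, toComplex_refOrbit, hγ.toComplex_eq, ← hU, mul_comm, mul_smul,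
    Matrix.mulVec_smul]

theorem exists_isOrbitalCoherentState (hd : 2 ≤ d) {E : ℝ} (hE : 0 < E) {ħ : ℝ} (hħ : 0 < ħ)
    (N : ℕ) {γ : ℝ → Phase d} (hγ : IsHamiltonianOrbit γ) (hγE : energy (γ 0) = E) :
    ∃ φ : StateSpace d, IsOrbitalCoherentState hd E hħ N γ φ := by
  obtain ⟨U, hU⟩ := exists_suAct_refOrbit hd hE hγ hγE
  obtain ⟨T, hT⟩ := exists_isMetaplectic hd hħ U
  refine ⟨T (refState hd hħ N), U, T, ?_, hT, rfl⟩
  rw [← Set.range_comp]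
  exact congrArg Set.range (funext hU)

/-- The ambiguity function of an orbital coherent state depends only on the orbit. -/
theorem IsOrbitalCoherentState.inner_weylOp {hd : 2 ≤ d} {E : ℝ} (hE : 0 < E) {ħ : ℝ}
    {hħ : 0 < ħ} {N : ℕ} {γ : ℝ → Phase d} (hγ : IsHamiltonianOrbit γ) {φ : StateSpace d}
    (hφ : IsOrbitalCoherentState hd E hħ N γ φ) (w : Phase d) :
    inner ℂ φ (weylOp ħ w φ) =
      ((laguerre N (‖herm (toComplex (γ 0)) (toComplex w)‖ ^ 2 / (4 * ħ * E)) *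
        Real.exp (-(‖w.1‖ ^ 2 + ‖w.2‖ ^ 2) / (4 * ħ)) : ℝ) : ℂ) := by
  obtain ⟨U, T, hU, hT, rfl⟩ := hφ
  rw [hT.inner_weylOp, inner_weylOp_refState, norm_sq_suAct]
  -- The orbits agree only as sets, up to a time shift `s`; it contributes a unimodular factor,
  -- invisible to the modulus of the Hermitian product.
  obtain ⟨s, hs⟩ : suAct U (refOrbit hd E 0) ∈ Set.range γ := by
    rw [← hU]
    exact Set.mem_image_of_mem _ (Set.mem_range_self 0)
  have h1 : toComplex (suAct U (refOrbit hd E 0)) =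
      Complex.exp (-(s * Complex.I)) • toComplex (γ 0) := by
    rw [← hs, hγ.toComplex_eq]
  have h2 : herm (toComplex (refOrbit hd E 0)) (toComplex (suAct U⁻¹ w)) =
      star (Complex.exp (-(s * Complex.I))) * herm (toComplex (γ 0)) (toComplex w) := by
    rw [← herm_mulVec U, ← toComplex_suAct, h1, ← toComplex_suAct, ← suAct_mul, mul_inv_cancel,
      suAct_one]
    have := herm_smul_smul (Complex.exp (-(s * Complex.I))) 1 (toComplex (γ 0)) (toComplex w)
    rwa [one_smul, mul_one] at this
  have h3 : herm (toComplex (refOrbit hd E 0)) (toComplex (suAct U⁻¹ w)) =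
      √E * herm (refVec hd) (toComplex (suAct U⁻¹ w)) := by
    have := herm_smul_smul (√E : ℂ) 1 (refVec hd) (toComplex (suAct U⁻¹ w))
    rw [one_smul] at this
    rw [toComplex_refOrbit]
    simpa using this
  have h4 : ‖herm (toComplex (γ 0)) (toComplex w)‖ =
      √E * ‖herm (refVec hd) (toComplex (suAct U⁻¹ w))‖ := by
    have h5 := congrArg norm (h2.symm.trans h3)
    have h6 : ‖Complex.exp (-(s * Complex.I))‖ = 1 := by
      rw [← neg_mul, ← Complex.ofReal_neg, Complex.norm_exp_ofReal_mul_I]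
    rwa [norm_mul, norm_star, h6, one_mul, norm_mul, Complex.norm_real,
      Real.norm_of_nonneg (Real.sqrt_nonneg E)] at h5
  rw [h4, mul_pow, Real.sq_sqrt hE.le, mul_comm E, mul_div_mul_right _ _ hE.ne']

end Orbits

/-! ### The Wigner distribution as a Fourier transform of the ambiguity function -/

section Wigner

open scoped FourierTransform

variable {d : ℕ}

/-- Phase space with its Euclidean norm. -/
abbrev EPhase (d : ℕ) : Type := WithLp 2 (Phase d)

theorem integral_ephase (f : EPhase d → ℂ) :
    ∫ v, f v = ∫ z : Phase d, f (WithLp.toLp 2 z) :=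
  ((WithLp.volume_preserving_toLp (Conf d) (Conf d)).integral_comp
    (MeasurableEquiv.toLp 2 (Phase d)).measurableEmbedding f).symm

theorem integrable_ephase_iff (f : EPhase d → ℂ) :
    Integrable f ↔ Integrable (fun z : Phase d => f (WithLp.toLp 2 z)) :=
  ((WithLp.volume_preserving_toLp (Conf d) (Conf d)).integrable_comp_emb
    (MeasurableEquiv.toLp 2 (Phase d)).measurableEmbedding).symm

theorem inner_ephase (z z' : Phase d) :
    inner ℝ (WithLp.toLp 2 z) (WithLp.toLp 2 z') = inner ℝ z.1 z'.1 + inner ℝ z.2 z'.2 := by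
  simp [WithLp.prod_inner_apply]

theorem norm_sq_ephase (v : EPhase d) : ‖v‖ ^ 2 = ‖v.fst‖ ^ 2 + ‖v.snd‖ ^ 2 :=
  WithLp.prod_norm_sq_eq_of_L2 v

/-- For a fixed shift, the correlation of a state with its translate is obtained from the
ambiguity function by Fourier inversion. -/
theorem ae_correlation_eq {ħ : ℝ} (hħ : 0 < ħ) (φ : StateSpace d) (a : Conf d → ℂ) (r : Conf d)
    (ha : Integrable a)
    (hA : ∀ s, inner ℂ φ (weylOp ħ ((2 * Real.pi * ħ) • r, -(2 * Real.pi * ħ) • s) φ) = a s) :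
    ∀ᵐ y : Conf d, φ (y - (Real.pi * ħ) • r) * (starRingEnd ℂ) (φ (y + (Real.pi * ħ) • r)) =
      𝓕⁻ a y := by
  set q : Conf d := (Real.pi * ħ) • r with hq
  have hħ' : (ħ : ℂ) ≠ 0 := by exact_mod_cast hħ.ne'
  set k : Conf d → ℂ := fun y => φ (y - q) * (starRingEnd ℂ) (φ (y + q)) with hk
  have hkint : Integrable k := by
    have h1 : MemLp (fun y : Conf d => φ (y - q)) 2 volume :=
      (Lp.memLp φ).comp_measurePreserving (measurePreserving_sub_right volume q)
    have h2 : MemLp (fun y : Conf d => (starRingEnd ℂ) (φ (y + q))) 2 volume :=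
      ((Lp.memLp φ).comp_measurePreserving (measurePreserving_add_right volume q)).star
    exact h1.integrable_mul h2
  -- Substituting `y = x - q` makes the correlation one-sided; the resulting phase is the symmetric
  -- half phase of the Weyl operator.
  have hkF : 𝓕 k = a := by
    ext s
    rw [← hA, inner_weylOp_eq_integral ħ _ φ φ (EventuallyEq.refl _ _) (EventuallyEq.refl _ _),
      Real.fourier_eq', ← integral_sub_right_eq_self _ q]
    refine integral_congr_ae (Eventually.of_forall fun x => ?_)
    have e1 : x - q - q = x - (2 * Real.pi * ħ) • r := by
      rw [hq]
      module
    simp only [hk, weylFun, smul_eq_mul, sub_add_cancel, e1]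
    rw [mul_comm (φ _), mul_left_comm]
    congr 4
    simp only [hq, inner_sub_left, inner_smul_left, inner_smul_right, conj_trivial,
      real_inner_comm s x, real_inner_comm s r]
    field_simp
    ring_nf
  have := ae_eq_fourierInv_fourier hkint (by rwa [hkF])
  rwa [hkF] at this

/-- Inverse Fourier transformation on phase space is done in `s` first, giving the correlation of
`φ` at separation `2πħ r`, and then in `r`, which is the Wigner integral. -/
theorem wigner_ae_eq {ħ : ℝ} (hħ : 0 < ħ) (φ : StateSpace d) (a : EPhase d → ℂ)
    (hac : Continuous a) (ha : Integrable a)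
    (hslice : ∀ r : Conf d, Integrable (fun s : Conf d => a (WithLp.toLp 2 (s, r))))
    (hA : ∀ s r : Conf d, inner ℂ φ (weylOp ħ ((2 * Real.pi * ħ) • r, -(2 * Real.pi * ħ) • s) φ) =
      a (WithLp.toLp 2 (s, r))) :
    ∀ᵐ z : Phase d, wigner ħ φ z = 𝓕⁻ a (WithLp.toLp 2 z) := by
  have hħ' : (ħ : ℂ) ≠ 0 := by exact_mod_cast hħ.ne'
  set B : Conf d → Conf d → ℂ := fun r y => 𝓕⁻ (fun s : Conf d => a (WithLp.toLp 2 (s, r))) y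
    with hB
  have h1 : ∀ᵐ r : Conf d, ∀ᵐ y : Conf d,
      φ (y - (Real.pi * ħ) • r) * (starRingEnd ℂ) (φ (y + (Real.pi * ħ) • r)) = B r y :=
    Eventually.of_forall fun r => ae_correlation_eq hħ φ _ r (hslice r) fun s => hA s r
  have hφ : Measurable φ := (Lp.stronglyMeasurable φ).measurable
  have hBm : Measurable (fun p : Conf d × Conf d => B p.1 p.2) := by
    have : StronglyMeasurable (fun p : Conf d × Conf d => ∫ s : Conf d,
        Complex.exp ((2 * Real.pi * inner ℝ s p.2 : ℝ) * Complex.I) •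
          a (WithLp.toLp 2 (s, p.1))) := by
      refine StronglyMeasurable.integral_prod_right (f := fun p : Conf d × Conf d => fun s : Conf d =>
        Complex.exp ((2 * Real.pi * inner ℝ s p.2 : ℝ) * Complex.I) •
          a (WithLp.toLp 2 (s, p.1))) ?_
      refine Continuous.stronglyMeasurable ?_
      simp only [Function.uncurry_def]
      fun_prop
    simpa only [hB, Real.fourierInv_eq'] using this.measurable
  have hset : MeasurableSet {p : Conf d × Conf d |
      φ (p.2 - (Real.pi * ħ) • p.1) * (starRingEnd ℂ) (φ (p.2 + (Real.pi * ħ) • p.1)) =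
        B p.1 p.2} := by
    refine measurableSet_eq_fun (Measurable.mul ?_ ?_) hBm
    · exact hφ.comp (by fun_prop)
    · exact Complex.continuous_conj.measurable.comp (hφ.comp (by fun_prop))
  -- The correlation identity holds for every `r` and almost every `y`; the Wigner integral at a
  -- fixed position needs the quantifiers in the other order.
  rw [Measure.ae_ae_comm hset] at h1
  have h2 := (Measure.quasiMeasurePreserving_fst (μ := (volume : Measure (Conf d)))
    (ν := (volume : Measure (Conf d)))).ae h1
  filter_upwards [h2] with z hz
  have hint : Integrable (fun u : Phase d =>
      Complex.exp ((2 * Real.pi * (inner ℝ u.1 z.1 + inner ℝ u.2 z.2) : ℝ) * Complex.I) *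
        a (WithLp.toLp 2 u)) := by
    refine ((integrable_ephase_iff a).1 ha).bdd_mul (c := 1)
      (Continuous.aestronglyMeasurable (by fun_prop)) (Eventually.of_forall fun u => ?_)
    rw [Complex.norm_exp_ofReal_mul_I]
  rw [Real.fourierInv_eq', integral_ephase]
  simp only [inner_ephase, smul_eq_mul]
  change _ = ∫ u : Conf d × Conf d, _ ∂(volume.prod volume)
  rw [integral_prod_symm _ hint]
  rw [wigner, ← integral_neg_eq_self]
  -- The substitution `v = 2πħ r` produces exactly the prefactor `(2πħ)^(-d)`.
  have hscale := Measure.integral_comp_smul (μ := (volume : Measure (Conf d)))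
    (fun v : Conf d => φ (z.1 + (1 / 2 : ℝ) • -v) * (starRingEnd ℂ) (φ (z.1 - (1 / 2 : ℝ) • -v)) *
      Complex.exp (-Complex.I / ħ * (inner ℝ (-v) z.2 : ℝ))) (2 * Real.pi * ħ)
  have hpos : 0 < (2 * Real.pi) ^ d * ħ ^ d := by positivity
  have hconst : |((2 * Real.pi * ħ) ^ Module.finrank ℝ (Conf d))⁻¹| =
      ((2 * Real.pi) ^ d * ħ ^ d)⁻¹ := by
    rw [finrank_euclideanSpace_fin, mul_pow, abs_of_pos (inv_pos.2 hpos)]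
  rw [hconst, Complex.real_smul] at hscale
  rw [← hscale]
  refine integral_congr_ae ?_
  filter_upwards [hz] with r hr
  have e1 : z.1 + (1 / 2 : ℝ) • -((2 * Real.pi * ħ) • r) = z.1 - (Real.pi * ħ) • r := by module
  have e2 : z.1 - (1 / 2 : ℝ) • -((2 * Real.pi * ħ) • r) = z.1 + (Real.pi * ħ) • r := by module
  rw [e1, e2, hr]
  simp only [hB, Real.fourierInv_eq', smul_eq_mul]
  rw [← integral_mul_const]
  refine integral_congr_ae (Eventually.of_forall fun s => ?_)
  simp only [inner_neg_left, inner_smul_left, conj_trivial]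
  rw [mul_right_comm, ← Complex.exp_add]
  congr 2
  push_cast
  field_simp

end Wigner

/-! ### Gaussian bounds for Wigner distributions of orbital coherent states -/

section Bounds

open scoped FourierTransform

variable {d : ℕ}

/-- Termwise comparison with the binomial expansion of `(1 + 1/ε) ^ N`. The growth rate in `x` can
be made small enough for a Gaussian to beat. -/
theorem abs_laguerre_le (N : ℕ) {x ε : ℝ} (hx : 0 ≤ x) (hε : 0 < ε) :
    |laguerre N x| ≤ (1 + ε⁻¹) ^ N * Real.exp (ε * x) := by
  rw [laguerre, add_comm 1, add_pow, Finset.sum_mul]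
  refine (Finset.abs_sum_le_sum_abs _ _).trans (Finset.sum_le_sum fun k _ => ?_)
  have h := Real.pow_div_factorial_le_exp (ε * x) (by positivity) k
  rw [abs_div, abs_mul, abs_pow, abs_neg, abs_of_nonneg hx, Nat.abs_cast, Nat.abs_cast, one_pow,
    mul_one]
  calc _ = ε⁻¹ ^ k * (N.choose k : ℝ) * ((ε * x) ^ k / k.factorial) := by
        rw [mul_pow, inv_pow]
        field_simp
    _ ≤ _ := by gcongr

theorem continuous_toComplex : Continuous (toComplex (d := d)) := by
  have h : toComplex (d := d) = fun z j => (z.1 j : ℂ) + (z.2 j : ℂ) * Complex.I := by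
    ext z j
    apply Complex.ext <;> simp [toComplex]
  rw [h]
  fun_prop

theorem continuous_herm (ζ : Fin d → ℂ) : Continuous (herm ζ) := by
  unfold herm dotProduct
  fun_prop

theorem continuous_laguerre (N : ℕ) : Continuous (laguerre N) := by
  unfold laguerre
  fun_prop

theorem norm_sq_herm_le {ζ : Fin d → ℂ} {r : ℝ} (hζ : herm ζ ζ = r) (z : Phase d) :
    ‖herm ζ (toComplex z)‖ ^ 2 ≤ r * (‖z.1‖ ^ 2 + ‖z.2‖ ^ 2) := by
  have h1 : ‖WithLp.toLp 2 ζ‖ ^ 2 = r := by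
    rw [herm_self] at hζ
    exact_mod_cast hζ
  have h2 : ‖WithLp.toLp 2 (toComplex z)‖ ^ 2 = ‖z.1‖ ^ 2 + ‖z.2‖ ^ 2 := by
    have := herm_self_toComplex z
    rw [herm_self] at this
    exact_mod_cast this
  have h3 : herm ζ (toComplex z) = inner ℂ (WithLp.toLp 2 ζ) (WithLp.toLp 2 (toComplex z)) := by
    rw [EuclideanSpace.inner_eq_star_dotProduct, herm, dotProduct_comm]
  rw [h3, ← h1, ← h2, ← mul_pow]
  exact pow_le_pow_left₀ (norm_nonneg _) (norm_inner_le_norm _ _) 2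

/-- The characteristic function of the Wigner distribution of the orbital coherent state of the
orbit spanned by `ζ`. -/
noncomputable def charFn (ħ : ℝ) (N : ℕ) (ζ : Fin d → ℂ) (v : EPhase d) : ℂ :=
  ((laguerre N (Real.pi ^ 2 * ħ * ‖herm ζ (toComplex v.ofLp)‖ ^ 2) *
    Real.exp (-(Real.pi ^ 2 * ħ) * ‖v‖ ^ 2) : ℝ) : ℂ)

theorem continuous_charFn (ħ : ℝ) (N : ℕ) (ζ : Fin d → ℂ) : Continuous (charFn ħ N ζ) := by
  have h1 := continuous_herm ζ
  have h2 := continuous_toComplex (d := d)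
  have h3 := continuous_laguerre N
  have h4 : Continuous (fun v : EPhase d => herm ζ (toComplex v.ofLp)) :=
    h1.comp (h2.comp (WithLp.prod_continuous_ofLp 2 _ _))
  have h5 : Continuous (fun v : EPhase d =>
      laguerre N (Real.pi ^ 2 * ħ * ‖herm ζ (toComplex v.ofLp)‖ ^ 2)) :=
    h3.comp (by fun_prop)
  unfold charFn
  fun_prop

theorem norm_charFn_le {ħ : ℝ} (hħ : 0 < ħ) (N : ℕ) {ζ : Fin d → ℂ} (hζ : herm ζ ζ = 2)
    (v : EPhase d) :
    ‖charFn ħ N ζ v‖ ≤ 5 ^ N * Real.exp (-(Real.pi ^ 2 * ħ / 2) * ‖v‖ ^ 2) := by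
  have h1 := norm_sq_herm_le (r := 2) (by exact_mod_cast hζ) v.ofLp
  have h2 := norm_sq_ephase v
  -- Since `|⟨ζ, v⟩|² ≤ 2‖v‖²`, the choice `ε = 1/4` spends half of the Gaussian and gives `1 + 4 =
  -- 5`. The bound depends on `N` and serves only for integrability.
  have h3 := abs_laguerre_le N (x := Real.pi ^ 2 * ħ * ‖herm ζ (toComplex v.ofLp)‖ ^ 2)
    (ε := 1 / 4) (by positivity) (by norm_num)
  rw [charFn, Complex.norm_real, norm_mul, Real.norm_eq_abs, Real.norm_of_nonneg (Real.exp_pos _).le]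
  calc _ ≤ (1 + (1 / 4 : ℝ)⁻¹) ^ N *
        Real.exp (1 / 4 * (Real.pi ^ 2 * ħ * ‖herm ζ (toComplex v.ofLp)‖ ^ 2)) *
        Real.exp (-(Real.pi ^ 2 * ħ) * ‖v‖ ^ 2) := by gcongr
    _ = 5 ^ N * Real.exp (1 / 4 * (Real.pi ^ 2 * ħ * ‖herm ζ (toComplex v.ofLp)‖ ^ 2) +
        -(Real.pi ^ 2 * ħ) * ‖v‖ ^ 2) := by
        rw [Real.exp_add, ← mul_assoc]
        norm_num [mul_assoc]
    _ ≤ _ := by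
        gcongr
        have h4 : ‖herm ζ (toComplex v.ofLp)‖ ^ 2 ≤ 2 * ‖v‖ ^ 2 := by
          rw [h2]
          exact h1
        have h5 := mul_le_mul_of_nonneg_left h4 (by positivity : 0 ≤ Real.pi ^ 2 * ħ / 4)
        linarith

theorem integrable_charFn {ħ : ℝ} (hħ : 0 < ħ) (N : ℕ) {ζ : Fin d → ℂ} (hζ : herm ζ ζ = 2) :
    Integrable (charFn ħ N ζ) :=
  ((integrable_exp_neg_mul_norm_sq (V := EPhase d) (b := Real.pi ^ 2 * ħ / 2)
    (by positivity)).const_mul (5 ^ N)).mono' (continuous_charFn ħ N ζ).aestronglyMeasurable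
    (Eventually.of_forall (norm_charFn_le hħ N hζ))

theorem integrable_charFn_slice {ħ : ℝ} (hħ : 0 < ħ) (N : ℕ) {ζ : Fin d → ℂ} (hζ : herm ζ ζ = 2)
    (r : Conf d) : Integrable (fun s : Conf d => charFn ħ N ζ (WithLp.toLp 2 (s, r))) := by
  have hc : Continuous (fun s : Conf d => charFn ħ N ζ (WithLp.toLp 2 (s, r))) :=
    (continuous_charFn ħ N ζ).comp (by fun_prop)
  refine ((integrable_exp_neg_mul_norm_sq (V := Conf d) (b := Real.pi ^ 2 * ħ / 2)
    (by positivity)).const_mul (5 ^ N)).mono' hc.aestronglyMeasurable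
    (Eventually.of_forall fun s => (norm_charFn_le hħ N hζ _).trans ?_)
  gcongr 5 ^ N * Real.exp ?_
  have h := norm_sq_ephase (WithLp.toLp 2 (s, r) : EPhase d)
  rw [h]
  change -(Real.pi ^ 2 * ħ / 2) * (‖s‖ ^ 2 + ‖r‖ ^ 2) ≤ -(Real.pi ^ 2 * ħ / 2) * ‖s‖ ^ 2
  have h2 : 0 ≤ Real.pi ^ 2 * ħ / 2 * ‖r‖ ^ 2 := by positivity
  linarith

/-- The ambiguity function of `φ` is the one of the orbital coherent states of the orbit
spanned by `ζ`. -/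
def HasLaguerreAmbiguity (ħ : ℝ) (N : ℕ) (ζ : Fin d → ℂ) (φ : StateSpace d) : Prop :=
  ∀ w : Phase d, inner ℂ φ (weylOp ħ w φ) =
    ((laguerre N (‖herm ζ (toComplex w)‖ ^ 2 / (4 * ħ)) *
      Real.exp (-(‖w.1‖ ^ 2 + ‖w.2‖ ^ 2) / (4 * ħ)) : ℝ) : ℂ)

/-- The argument of the Weyl operator is `-2πiħ` times `s + ir`, which turns `1 / (4ħ)` into `π²ħ`.
-/
theorem HasLaguerreAmbiguity.charFn_eq {ħ : ℝ} (hħ : 0 < ħ) {N : ℕ} {ζ : Fin d → ℂ}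
    {φ : StateSpace d} (hA : HasLaguerreAmbiguity ħ N ζ φ) (s r : Conf d) :
    inner ℂ φ (weylOp ħ ((2 * Real.pi * ħ) • r, -(2 * Real.pi * ħ) • s) φ) =
      charFn ħ N ζ (WithLp.toLp 2 (s, r)) := by
  have h1 : toComplex ((2 * Real.pi * ħ) • r, -(2 * Real.pi * ħ) • s) =
      ((2 * Real.pi * ħ : ℝ) * -Complex.I : ℂ) • toComplex (s, r) := by
    ext j
    apply Complex.ext <;> simp [toComplex]
  have h2 := herm_smul_smul 1 ((2 * Real.pi * ħ : ℝ) * -Complex.I : ℂ) ζ (toComplex (s, r))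
  rw [one_smul, star_one, one_mul] at h2
  rw [hA, charFn, h1, h2, norm_sq_ephase]
  congr 3
  · rw [norm_mul, norm_mul, norm_neg, Complex.norm_I, Complex.norm_real,
      Real.norm_of_nonneg (by positivity)]
    field_simp
    ring
  · change _ = -(Real.pi ^ 2 * ħ) * (‖s‖ ^ 2 + ‖r‖ ^ 2)
    simp only [norm_smul, norm_neg, Real.norm_of_nonneg (by positivity : 0 ≤ 2 * Real.pi * ħ)]
    field_simp
    ring

/-- Cauchy–Schwarz for `φ` and its Weyl translate; the value at `w = 0` shows `‖φ‖ = 1`. This bound,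
uniform in `N`, drives the dominated convergence. -/
theorem HasLaguerreAmbiguity.norm_charFn_le_one {ħ : ℝ} (hħ : 0 < ħ) {N : ℕ} {ζ : Fin d → ℂ}
    {φ : StateSpace d} (hA : HasLaguerreAmbiguity ħ N ζ φ) (v : EPhase d) :
    ‖charFn ħ N ζ v‖ ≤ 1 := by
  have h0 := hA 0
  have hl : laguerre N 0 = 1 := by
    rw [laguerre, Finset.sum_eq_single_of_mem 0 (by simp) fun k _ hk => by simp [hk]]
    simp
  have hz : toComplex (0 : Phase d) = 0 := by
    ext j
    apply Complex.ext <;> simp [toComplex]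
  rw [weylOp_zero, hz] at h0
  simp only [herm, dotProduct_zero, norm_zero, Prod.fst_zero, Prod.snd_zero] at h0
  simp only [ne_eq, OfNat.ofNat_ne_zero, not_false_eq_true, zero_pow, zero_div, hl, add_zero,
    neg_zero, Real.exp_zero, mul_one, Complex.ofReal_one] at h0
  have h1 : ‖φ‖ ^ 2 = 1 := by
    rw [← inner_self_eq_norm_sq (𝕜 := ℂ), h0]
    simp
  have h2 := hA.charFn_eq hħ v.fst v.snd
  change _ = charFn ħ N ζ v at h2
  rw [← h2]
  refine (norm_inner_le_norm _ _).trans ?_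
  rw [norm_weylOp, ← sq, h1]

theorem wigner_ae_eq_fourierInv_charFn {ħ : ℝ} (hħ : 0 < ħ) {N : ℕ} {ζ : Fin d → ℂ}
    (hζ : herm ζ ζ = 2) {φ : StateSpace d} (hA : HasLaguerreAmbiguity ħ N ζ φ) :
    ∀ᵐ z : Phase d, wigner ħ φ z = 𝓕⁻ (charFn ħ N ζ) (WithLp.toLp 2 z) :=
  wigner_ae_eq hħ φ _ (continuous_charFn ħ N ζ) (integrable_charFn hħ N hζ)
    (integrable_charFn_slice hħ N hζ) (hA.charFn_eq hħ)

theorem norm_refStateFun_le (hd : 2 ≤ d) {ħ : ℝ} (N : ℕ) (x : Conf d) :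
    ‖refStateFun hd ħ N x‖ ≤
      |refConst d ħ N| * (2 * ‖x‖) ^ N * Real.exp (-‖x‖ ^ 2 / (2 * ħ)) := by
  rw [refStateFun_eq, norm_mul, norm_mul, norm_pow, Complex.norm_real, Complex.norm_real,
    Real.norm_of_nonneg (Real.exp_pos _).le, Real.norm_eq_abs]
  gcongr
  exact norm_coord_add_le x _ _ Complex.I (by simp)

/-- With `ρ = |x|² + |v|²/4`, the parallelogram law makes the Gaussians multiply to `exp(-ρ/ħ)` and
bounds the polynomial factors by `(4ρ)^N = (8ħ)^N (ρ/2ħ)^N`. The latter costs `N!` and half of the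
Gaussian. -/
theorem norm_refStateFun_mul_le (hd : 2 ≤ d) {ħ : ℝ} (hħ : 0 < ħ) (N : ℕ) (x v : Conf d) :
    ‖refStateFun hd ħ N (x + (1 / 2 : ℝ) • v)‖ * ‖refStateFun hd ħ N (x - (1 / 2 : ℝ) • v)‖ ≤
      refConst d ħ N ^ 2 * (8 ^ N * (ħ ^ N * N.factorial)) * Real.exp (-‖x‖ ^ 2 / (2 * ħ)) *
        Real.exp (-(1 / (8 * ħ)) * ‖v‖ ^ 2) := by
  set y := x + (1 / 2 : ℝ) • v with hy
  set y' := x - (1 / 2 : ℝ) • v with hy'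
  set ρ := ‖x‖ ^ 2 + ‖v‖ ^ 2 / 4 with hρ
  have hpar : ‖y‖ ^ 2 + ‖y'‖ ^ 2 = 2 * ρ := by
    rw [hy, hy', norm_add_sq_real, norm_sub_sq_real, norm_smul]
    norm_num
    rw [hρ]
    ring
  have hρ0 : 0 ≤ ρ := by positivity
  have h1 : 2 * ‖y‖ * (2 * ‖y'‖) ≤ 4 * ρ := by nlinarith [sq_nonneg (‖y‖ - ‖y'‖)]
  have h2 := Real.pow_div_factorial_le_exp (ρ / (2 * ħ)) (by positivity) N
  rw [div_le_iff₀ (by positivity)] at h2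
  have h3 : (4 * ρ) ^ N ≤ 8 ^ N * (ħ ^ N * N.factorial) * Real.exp (ρ / (2 * ħ)) := by
    have : (4 * ρ) ^ N = 8 ^ N * ħ ^ N * (ρ / (2 * ħ)) ^ N := by
      rw [← mul_pow, ← mul_pow]
      congr 1
      field_simp
      ring
    rw [this]
    calc _ ≤ 8 ^ N * ħ ^ N * (Real.exp (ρ / (2 * ħ)) * N.factorial) := by gcongr
      _ = _ := by ring
  have h4 : Real.exp (-‖y‖ ^ 2 / (2 * ħ)) * Real.exp (-‖y'‖ ^ 2 / (2 * ħ)) =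
      Real.exp (-ρ / ħ) := by
    rw [← Real.exp_add]
    congr 1
    rw [← add_div, ← neg_add, hpar]
    field_simp
  calc _ ≤ (|refConst d ħ N| * (2 * ‖y‖) ^ N * Real.exp (-‖y‖ ^ 2 / (2 * ħ))) *
        (|refConst d ħ N| * (2 * ‖y'‖) ^ N * Real.exp (-‖y'‖ ^ 2 / (2 * ħ))) :=
        mul_le_mul (norm_refStateFun_le hd N y) (norm_refStateFun_le hd N y') (norm_nonneg _)
          (by positivity)
    _ = refConst d ħ N ^ 2 * (2 * ‖y‖ * (2 * ‖y'‖)) ^ N * (Real.exp (-‖y‖ ^ 2 / (2 * ħ)) *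
        Real.exp (-‖y'‖ ^ 2 / (2 * ħ))) := by
        rw [mul_pow (2 * ‖y‖), ← sq_abs (refConst d ħ N)]
        ring
    _ ≤ refConst d ħ N ^ 2 * (8 ^ N * (ħ ^ N * N.factorial) * Real.exp (ρ / (2 * ħ))) *
        Real.exp (-ρ / ħ) := by
        rw [h4]
        gcongr
        exact (pow_le_pow_left₀ (by positivity) h1 N).trans h3
    _ = _ := by
        rw [mul_assoc, mul_assoc _ (Real.exp _) (Real.exp _), ← mul_assoc, ← mul_assoc,
          mul_assoc _ (Real.exp _) (Real.exp _), mul_assoc _ (Real.exp _) (Real.exp _),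
          ← Real.exp_add, ← Real.exp_add]
        congr 2
        rw [hρ]
        field_simp
        ring

/-- The constant in the Gaussian bound for Wigner distributions. -/
noncomputable def wignerConst (d : ℕ) (ħ : ℝ) (N : ℕ) : ℝ :=
  ((2 * Real.pi) ^ d * ħ ^ d)⁻¹ * (8 ^ ((d : ℝ) / 2) * 8 ^ N)

/-- Absolute values inside the Wigner integral discard the phase, so only decay in position results.
The normalization cancels `ħ^N N!` and leaves `8^N`. -/
theorem norm_wigner_refState_le (hd : 2 ≤ d) {ħ : ℝ} (hħ : 0 < ħ) (N : ℕ) (z : Phase d) :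
    ‖wigner ħ (refState hd hħ N) z‖ ≤
      wignerConst d ħ N * Real.exp (-‖z.1‖ ^ 2 / (2 * ħ)) := by
  have hae : refState hd hħ N =ᵐ[volume] refStateFun hd ħ N :=
    (memLp_refStateFun hd hħ N).coeFn_toLp
  have hq : ∀ (c : ℝ), c ≠ 0 → ∀ᵐ v : Conf d, refState hd hħ N (z.1 + c • v) =
      refStateFun hd ħ N (z.1 + c • v) := by
    intro c hc
    have h1 : Measure.QuasiMeasurePreserving (fun v : Conf d => z.1 + v) volume volume :=
      (measurePreserving_add_left volume z.1).quasiMeasurePreserving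
    have h2 : Measure.QuasiMeasurePreserving (fun v : Conf d => c • v) volume volume := by
      refine ⟨by fun_prop, ?_⟩
      rw [Measure.map_addHaar_smul volume hc]
      exact Measure.smul_absolutelyContinuous
    exact (h1.comp h2).ae_eq hae
  have hb : 0 < 1 / (8 * ħ) := by positivity
  set K := refConst d ħ N ^ 2 * (8 ^ N * (ħ ^ N * N.factorial)) *
    Real.exp (-‖z.1‖ ^ 2 / (2 * ħ)) with hK
  have hI : ‖∫ v : Conf d, refState hd hħ N (z.1 + (1 / 2 : ℝ) • v) *
      (starRingEnd ℂ) (refState hd hħ N (z.1 - (1 / 2 : ℝ) • v)) *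
      Complex.exp (-Complex.I / ħ * (inner ℝ v z.2 : ℝ))‖ ≤
      ∫ v : Conf d, K * Real.exp (-(1 / (8 * ħ)) * ‖v‖ ^ 2) := by
    refine norm_integral_le_of_norm_le ((integrable_exp_neg_mul_norm_sq hb).const_mul K) ?_
    filter_upwards [hq (1 / 2) (by norm_num), hq (-(1 / 2)) (by norm_num)] with v h1 h2
    rw [neg_smul, ← sub_eq_add_neg] at h2
    have h3 : ‖Complex.exp (-Complex.I / ħ * (inner ℝ v z.2 : ℝ))‖ = 1 := by
      rw [show -Complex.I / ħ * ((inner ℝ v z.2 : ℝ) : ℂ) =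
        ((-(inner ℝ v z.2 / ħ) : ℝ) : ℂ) * Complex.I by push_cast; ring]
      exact Complex.norm_exp_ofReal_mul_I _
    rw [norm_mul, norm_mul, h3, mul_one, RCLike.norm_conj, h1, h2]
    exact norm_refStateFun_mul_le hd hħ N z.1 v
  rw [integral_const_mul, GaussianFourier.integral_rexp_neg_mul_sq_norm hb,
    finrank_euclideanSpace_fin] at hI
  have h4 : (Real.pi / (1 / (8 * ħ))) ^ ((d : ℝ) / 2) =
      8 ^ ((d : ℝ) / 2) * (Real.pi * ħ) ^ ((d : ℝ) / 2) := by
    rw [← Real.mul_rpow (by norm_num) (by positivity)]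
    congr 1
    field_simp
  have h5 : K * (Real.pi / (1 / (8 * ħ))) ^ ((d : ℝ) / 2) =
      8 ^ ((d : ℝ) / 2) * 8 ^ N * Real.exp (-‖z.1‖ ^ 2 / (2 * ħ)) := by
    rw [h4, hK]
    linear_combination (8 ^ ((d : ℝ) / 2) * 8 ^ N * Real.exp (-‖z.1‖ ^ 2 / (2 * ħ))) *
      refConst_sq_mul (d := d) hħ N
  rw [h5] at hI
  rw [wigner, norm_mul, Complex.norm_real, Real.norm_of_nonneg (by positivity), wignerConst,
    mul_assoc]
  gcongr

end Bounds

/-! ### Unitary covariance of Wigner distributions -/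

section Covariance

open scoped FourierTransform

variable {d : ℕ}

/-- The action of `SU(d)` on phase space as a linear isometry. -/
noncomputable def suIsometry (U : Matrix.specialUnitaryGroup (Fin d) ℂ) :
    EPhase d ≃ₗᵢ[ℝ] EPhase d :=
  LinearIsometry.toLinearIsometryEquiv
    { toFun := fun v => WithLp.toLp 2 (suAct U v.ofLp)
      map_add' := fun v v' => by rw [WithLp.ofLp_add, suAct_add, WithLp.toLp_add]
      map_smul' := fun c v => by
        rw [WithLp.ofLp_smul, suAct_smul, WithLp.toLp_smul, RingHom.id_apply]
      norm_map' := fun v => by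
        refine (sq_eq_sq₀ (norm_nonneg _) (norm_nonneg _)).1 ?_
        rw [norm_sq_ephase v]
        exact (norm_sq_ephase _).trans (norm_sq_suAct U v.ofLp) } rfl

theorem suIsometry_apply (U : Matrix.specialUnitaryGroup (Fin d) ℂ) (v : EPhase d) :
    suIsometry U v = WithLp.toLp 2 (suAct U v.ofLp) := rfl

/-- The rotation `(x, ξ) ↦ (ξ, -x)` of phase space, the Hamiltonian flow at time `π / 2`. -/
noncomputable def quarterTurn (d : ℕ) : EPhase d ≃ₗᵢ[ℝ] EPhase d :=
  LinearIsometry.toLinearIsometryEquiv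
    { toFun := fun v => WithLp.toLp 2 (v.snd, -v.fst)
      map_add' := fun v v' => congrArg (WithLp.toLp 2) (Prod.ext rfl (neg_add _ _))
      map_smul' := fun c v => congrArg (WithLp.toLp 2) (Prod.ext rfl (smul_neg c _).symm)
      norm_map' := fun v => by
        refine (sq_eq_sq₀ (norm_nonneg _) (norm_nonneg _)).1 ?_
        rw [norm_sq_ephase v]
        refine (norm_sq_ephase _).trans ?_
        change ‖v.snd‖ ^ 2 + ‖-v.fst‖ ^ 2 = _
        rw [norm_neg, add_comm] } rfl

theorem quarterTurn_apply (v : EPhase d) : quarterTurn d v = WithLp.toLp 2 (v.snd, -v.fst) := rfl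

theorem charFn_mulVec (ħ : ℝ) (N : ℕ) (ζ : Fin d → ℂ) (U : Matrix.specialUnitaryGroup (Fin d) ℂ) :
    charFn ħ N ((U : Matrix (Fin d) (Fin d) ℂ).mulVec ζ) = charFn ħ N ζ ∘ suIsometry U⁻¹ := by
  ext v
  have h : herm ((U : Matrix (Fin d) (Fin d) ℂ).mulVec ζ) (toComplex v.ofLp) =
      herm ζ (toComplex (suAct U⁻¹ v.ofLp)) := by
    rw [← herm_mulVec U ζ, ← toComplex_suAct, ← suAct_mul, mul_inv_cancel, suAct_one]
  rw [Function.comp_apply, charFn, charFn, LinearIsometryEquiv.norm_map, h, suIsometry_apply]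

theorem charFn_quarterTurn (ħ : ℝ) (N : ℕ) (ζ : Fin d → ℂ) :
    charFn ħ N ζ ∘ quarterTurn d = charFn ħ N ζ := by
  ext v
  have h1 : toComplex (quarterTurn d v).ofLp = -Complex.I • toComplex v.ofLp := by
    ext j
    apply Complex.ext <;> simp [toComplex, quarterTurn_apply]
  have h2 := herm_smul_smul 1 (-Complex.I) ζ (toComplex v.ofLp)
  rw [one_smul, star_one, one_mul] at h2
  rw [Function.comp_apply, charFn, charFn, LinearIsometryEquiv.norm_map, h1, h2, norm_mul,
    norm_neg, Complex.norm_I, one_mul]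

theorem refState_hasLaguerreAmbiguity (hd : 2 ≤ d) {ħ : ℝ} (hħ : 0 < ħ) (N : ℕ) :
    HasLaguerreAmbiguity ħ N (refVec hd) (refState hd hħ N) :=
  inner_weylOp_refState hd hħ N

/-- Invariance under the quarter turn, which exchanges position and momentum up to sign, converts
decay in position into decay in momentum. The geometric mean of the two bounds has rate `1 / (4ħ)`.
Continuity upgrades the almost everywhere bound to all points. -/
theorem norm_fourierInv_charFn_refVec_le (hd : 2 ≤ d) {ħ : ℝ} (hħ : 0 < ħ) (N : ℕ)
    (v : EPhase d) :
    ‖𝓕⁻ (charFn ħ N (refVec hd)) v‖ ≤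
      wignerConst d ħ N * Real.exp (-‖v‖ ^ 2 / (4 * ħ)) := by
  have hζ := herm_refVec_self hd
  set W : EPhase d → ℂ := 𝓕⁻ (charFn ħ N (refVec hd)) with hW
  have hWc : Continuous W := continuous_fourierInv (integrable_charFn hħ N hζ)
  have hfst : ∀ v : EPhase d, ‖W v‖ ≤ wignerConst d ħ N * Real.exp (-‖v.fst‖ ^ 2 / (2 * ħ)) := by
    have hclosed : IsClosed {z : Phase d | ‖W (WithLp.toLp 2 z)‖ ≤
        wignerConst d ħ N * Real.exp (-‖z.1‖ ^ 2 / (2 * ħ))} := by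
      have : Continuous (fun z : Phase d => W (WithLp.toLp 2 z)) :=
        hWc.comp (WithLp.prod_continuous_toLp 2 _ _)
      exact isClosed_le (by fun_prop) (by fun_prop)
    have hdense : Dense {z : Phase d | ‖W (WithLp.toLp 2 z)‖ ≤
        wignerConst d ħ N * Real.exp (-‖z.1‖ ^ 2 / (2 * ħ))} := by
      refine Measure.dense_of_ae (μ := (volume : Measure (Phase d))) ?_
      filter_upwards [wigner_ae_eq_fourierInv_charFn hħ hζ
        (refState_hasLaguerreAmbiguity hd hħ N)] with z hz
      rw [show W (WithLp.toLp 2 z) = _ from hz.symm]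
      exact norm_wigner_refState_le hd hħ N z
    intro v
    have : v.ofLp ∈ {z : Phase d | ‖W (WithLp.toLp 2 z)‖ ≤
        wignerConst d ħ N * Real.exp (-‖z.1‖ ^ 2 / (2 * ħ))} := by
      rw [← hclosed.closure_eq]
      exact hdense _
    exact this
  have hsnd : ‖W v‖ ≤ wignerConst d ħ N * Real.exp (-‖v.snd‖ ^ 2 / (2 * ħ)) := by
    have h1 := hfst (quarterTurn d v)
    have h2 := Real.fourierInv_comp_linearIsometry (quarterTurn d) (charFn ħ N (refVec hd)) v
    rw [charFn_quarterTurn] at h2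
    change W v = W (quarterTurn d v) at h2
    rw [← h2] at h1
    exact h1
  have hB : 0 ≤ wignerConst d ħ N := by
    unfold wignerConst
    positivity
  have h3 := mul_le_mul (hfst v) hsnd (norm_nonneg _) (by positivity)
  refine (sq_le_sq₀ (norm_nonneg _) (by positivity)).1 ?_
  calc ‖W v‖ ^ 2 = ‖W v‖ * ‖W v‖ := sq _
    _ ≤ _ := h3
    _ = wignerConst d ħ N ^ 2 * (Real.exp (-‖v.fst‖ ^ 2 / (2 * ħ)) *
        Real.exp (-‖v.snd‖ ^ 2 / (2 * ħ))) := by ring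
    _ = _ := by
        rw [mul_pow, ← Real.exp_add, ← Real.exp_nat_mul, norm_sq_ephase v]
        congr 2
        push_cast
        field_simp
        ring

theorem norm_fourierInv_charFn_le (hd : 2 ≤ d) {ħ : ℝ} (hħ : 0 < ħ) (N : ℕ) {ζ : Fin d → ℂ}
    (hζ : herm ζ ζ = 2) (v : EPhase d) :
    ‖𝓕⁻ (charFn ħ N ζ) v‖ ≤ wignerConst d ħ N * Real.exp (-‖v‖ ^ 2 / (4 * ħ)) := by
  obtain ⟨U, rfl⟩ := exists_specialUnitary_mulVec hd (r := 2) two_pos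
    (by simpa using herm_refVec_self hd) (by simpa using hζ)
  rw [charFn_mulVec, Real.fourierInv_comp_linearIsometry, ← (suIsometry U⁻¹).norm_map v]
  exact norm_fourierInv_charFn_refVec_le hd hħ N _

end Covariance

/-! ### The semiclassical limit of the characteristic functions -/

section Limit

/-- Termwise, `C(N, k) x^k` tends to `y^k / k!`. The limit series is `J₀(2√y)`. In the domination
`C(N, k) ≤ N^k` loses one factorial, and the other still ensures summability. -/
theorem tendsto_laguerre {x : ℕ → ℝ} {y : ℝ} (hx : ∀ N, 0 ≤ x N)
    (hlim : Tendsto (fun N : ℕ => (N : ℝ) * x N) atTop (𝓝 y)) (hx0 : Tendsto x atTop (𝓝 0)) :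
    Tendsto (fun N => laguerre N (x N)) atTop
      (𝓝 (∑' k : ℕ, (-y) ^ k / ((k.factorial : ℝ) * k.factorial))) := by
  have h1 : ∀ N, laguerre N (x N) =
      ∑' k : ℕ, (N.choose k : ℝ) * (-x N) ^ k / k.factorial := by
    intro N
    rw [laguerre, tsum_eq_sum]
    intro k hk
    have : N < k := by simpa [Nat.lt_succ_iff] using hk
    simp [Nat.choose_eq_zero_of_lt this]
  simp only [h1]
  have hev : ∀ᶠ N : ℕ in atTop, (N : ℝ) * x N ≤ y + 1 :=
    (hlim.eventually_lt_const (lt_add_one y)).mono fun N h => h.le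
  refine tendsto_tsum_of_dominated_convergence (bound := fun k => (y + 1) ^ k / k.factorial)
    (Real.summable_pow_div_factorial _) (fun k => ?_) ?_
  · have h2 : ∀ N : ℕ, (N.choose k : ℝ) * (-x N) ^ k / k.factorial =
        (∏ i ∈ Finset.range k, (((N - i : ℕ) : ℝ) * -x N)) /
          ((k.factorial : ℝ) * k.factorial) := by
      intro N
      have h3 : (N.choose k : ℝ) = (∏ i ∈ Finset.range k, ((N - i : ℕ) : ℝ)) / k.factorial := by
        rw [← Nat.cast_prod, ← Nat.descFactorial_eq_prod_range, Nat.choose_eq_descFactorial_div_factorial,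
          Nat.cast_div (Nat.factorial_dvd_descFactorial N k) (by exact_mod_cast k.factorial_ne_zero)]
      rw [h3, Finset.prod_mul_distrib, Finset.prod_const, Finset.card_range]
      field_simp
    simp only [h2]
    refine Tendsto.div_const ?_ _
    have h4 : ∀ i ∈ Finset.range k,
        Tendsto (fun N : ℕ => ((N - i : ℕ) : ℝ) * -x N) atTop (𝓝 (-y)) := by
      intro i _
      have h5 : Tendsto (fun N : ℕ => -((N : ℝ) * x N) + i * x N) atTop (𝓝 (-y + i * 0)) :=
        hlim.neg.add (hx0.const_mul _)
      rw [mul_zero, add_zero] at h5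
      refine h5.congr' ?_
      filter_upwards [eventually_ge_atTop i] with N hN
      rw [Nat.cast_sub hN]
      ring
    have h6 := tendsto_finsetProd (Finset.range k) h4
    rwa [Finset.prod_const, Finset.card_range] at h6
  · filter_upwards [hev] with N hN k
    rw [Real.norm_eq_abs, abs_div, abs_mul, abs_pow, abs_neg, abs_of_nonneg (hx N), Nat.abs_cast,
      Nat.abs_cast]
    gcongr
    have h7 : (N.choose k : ℝ) ≤ (N : ℝ) ^ k := by exact_mod_cast Nat.choose_le_pow N k
    calc _ ≤ (N : ℝ) ^ k * x N ^ k := by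
          have := hx N
          gcongr
      _ = ((N : ℝ) * x N) ^ k := (mul_pow _ _ _).symm
      _ ≤ _ := by
          have := hx N
          gcongr

/-- Only the `β` exponential is expanded; each term then picks a Taylor coefficient of `z ↦ exp (α
z)` on the unit circle. -/
theorem integral_exp_circle (α β : ℂ) :
    ∫ t in (0 : ℝ)..2 * Real.pi,
      Complex.exp (α * Complex.exp (t * Complex.I) + β * Complex.exp (-(t * Complex.I))) =
      2 * Real.pi * ∑' k : ℕ, (α * β) ^ k / ((k.factorial : ℂ) * k.factorial) := by
  set F : ℕ → ℝ → ℂ := fun k t => β ^ k / k.factorial *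
    (Complex.exp (-(t * Complex.I)) ^ k * Complex.exp (α * Complex.exp (t * Complex.I))) with hF
  have hn : ∀ t : ℝ, ‖Complex.exp (-(t * Complex.I))‖ = 1 := fun t => by
    rw [← neg_mul, ← Complex.ofReal_neg, Complex.norm_exp_ofReal_mul_I]
  have h1 : HasSum (fun k => ∫ t in (0 : ℝ)..2 * Real.pi, F k t)
      (∫ t in (0 : ℝ)..2 * Real.pi,
        Complex.exp (α * Complex.exp (t * Complex.I) + β * Complex.exp (-(t * Complex.I)))) := by
    refine intervalIntegral.hasSum_integral_of_dominated_convergence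
      (fun k _ => ‖β‖ ^ k / k.factorial * Real.exp ‖α‖) (fun k => ?_) (fun k => ?_) ?_ ?_ ?_
    · refine Continuous.aestronglyMeasurable ?_
      simp only [hF]
      fun_prop
    · refine Eventually.of_forall fun t _ => ?_
      rw [hF]
      simp only [norm_mul, norm_div, norm_pow, hn, one_pow, one_mul, Complex.norm_natCast]
      gcongr
      rw [Complex.norm_exp]
      refine Real.exp_le_exp.2 ((Complex.re_le_norm _).trans ?_)
      rw [norm_mul, Complex.norm_exp_ofReal_mul_I, mul_one]
    · exact Eventually.of_forall fun t _ => (Real.summable_pow_div_factorial _).mul_right _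
    · exact intervalIntegrable_const
    · refine Eventually.of_forall fun t _ => ?_
      have h2 := NormedSpace.expSeries_div_hasSum_exp (β * Complex.exp (-(t * Complex.I)))
      rw [← Complex.exp_eq_exp_ℂ] at h2
      have h3 := h2.mul_right (Complex.exp (α * Complex.exp (t * Complex.I)))
      rw [← Complex.exp_add, add_comm] at h3
      refine h3.congr_fun fun k => ?_
      simp only [hF, mul_pow]
      ring
  rw [← h1.tsum_eq, ← tsum_mul_left]
  congr 1
  ext k
  have h4 := cauchyCoeff_exp k α
  rw [cauchyCoeff, circleIntegral] at h4
  have h5 : ∀ t : ℝ, deriv (circleMap 0 1) t • (1 / circleMap 0 1 t ^ (k + 1) *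
      Complex.exp (circleMap 0 1 t * α)) = Complex.I * (Complex.exp (-(t * Complex.I)) ^ k *
        Complex.exp (α * Complex.exp (t * Complex.I))) := by
    intro t
    have h6 : Complex.exp (t * Complex.I) ≠ 0 := Complex.exp_ne_zero _
    simp only [deriv_circleMap, circleMap, Complex.ofReal_one, one_mul, zero_add, smul_eq_mul,
      Complex.exp_neg, inv_pow]
    rw [pow_succ, mul_comm α]
    field_simp
  simp only [h5] at h4
  rw [intervalIntegral.integral_const_mul] at h4
  simp only [hF]
  rw [intervalIntegral.integral_const_mul, mul_pow]
  have hpi : (Real.pi : ℂ) ≠ 0 := by exact_mod_cast Real.pi_ne_zero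
  have hk : (k.factorial : ℂ) ≠ 0 := by exact_mod_cast k.factorial_ne_zero
  have h7 : ∫ t in (0 : ℝ)..2 * Real.pi, (Complex.exp (-(t * Complex.I)) ^ k *
      Complex.exp (α * Complex.exp (t * Complex.I))) = 2 * Real.pi * (α ^ k / k.factorial) := by
    have h8 : 2 * (Real.pi : ℂ) * (2 * Real.pi * Complex.I)⁻¹ * Complex.I = 1 := by field_simp
    rw [← h4, ← mul_assoc, ← mul_assoc, h8, one_mul]
  rw [h7]
  field_simp

end Limit

/-! ### Convergence of the Wigner distributions to the orbit measure -/

section Convergence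

open scoped FourierTransform SchwartzMap

variable {d : ℕ}

/-- The direction `ζ` in `ℂ^d` of the complex line of an orbit of energy `E`. -/
noncomputable def orbitVec (E : ℝ) (γ : ℝ → Phase d) : Fin d → ℂ :=
  ((√E)⁻¹ : ℂ) • toComplex (γ 0)

theorem herm_orbitVec_self {E : ℝ} (hE : 0 < E) {γ : ℝ → Phase d} (hγE : energy (γ 0) = E) :
    herm (orbitVec E γ) (orbitVec E γ) = 2 := by
  have h1 : ((√E : ℝ) : ℂ) ≠ 0 := by exact_mod_cast (Real.sqrt_pos.2 hE).ne'
  have h2 : ((√E : ℝ) : ℂ) * (√E : ℝ) = E := by exact_mod_cast Real.mul_self_sqrt hE.le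
  have h3 : ((‖(γ 0).1‖ ^ 2 + ‖(γ 0).2‖ ^ 2 : ℝ) : ℂ) = 2 * E := by
    rw [← hγE, energy]
    push_cast
    ring
  rw [orbitVec, herm_smul_smul, herm_self_toComplex, h3, star_inv₀, RCLike.star_def,
    Complex.conj_ofReal, ← mul_inv, h2]
  have : (E : ℂ) ≠ 0 := by exact_mod_cast hE.ne'
  field_simp

theorem norm_sq_herm_orbitVec {E : ℝ} (hE : 0 < E) (γ : ℝ → Phase d) (v : Fin d → ℂ) :
    ‖herm (orbitVec E γ) v‖ ^ 2 = ‖herm (toComplex (γ 0)) v‖ ^ 2 / E := by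
  have h := herm_smul_smul ((√E)⁻¹ : ℂ) 1 (toComplex (γ 0)) v
  rw [one_smul, mul_one] at h
  rw [orbitVec, h, norm_mul, norm_star, norm_inv, Complex.norm_real,
    Real.norm_of_nonneg (Real.sqrt_nonneg E), mul_pow, inv_pow, Real.sq_sqrt hE.le]
  field_simp

theorem IsOrbitalCoherentState.hasLaguerreAmbiguity {hd : 2 ≤ d} {E : ℝ} (hE : 0 < E) {ħ : ℝ}
    {hħ : 0 < ħ} {N : ℕ} {γ : ℝ → Phase d} (hγ : IsHamiltonianOrbit γ) {φ : StateSpace d}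
    (hφ : IsOrbitalCoherentState hd E hħ N γ φ) :
    HasLaguerreAmbiguity ħ N (orbitVec E γ) φ := by
  intro w
  rw [hφ.inner_weylOp hE hγ, norm_sq_herm_orbitVec hE, div_div, mul_comm E]

theorem inner_eq_re_herm (z z' : Phase d) :
    inner ℝ z.1 z'.1 + inner ℝ z.2 z'.2 = (herm (toComplex z) (toComplex z')).re := by
  rw [herm_toComplex]
  simp

theorem IsHamiltonianOrbit.continuous {γ : ℝ → Phase d} (hγ : IsHamiltonianOrbit γ) :
    Continuous γ := by
  rw [show γ = fun t => (γ t) from rfl, funext hγ.eq]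
  fun_prop

/-- The Fourier transform of the orbit measure is a Bessel function. -/
theorem IsHamiltonianOrbit.integral_exp {γ : ℝ → Phase d} (hγ : IsHamiltonianOrbit γ)
    (v : EPhase d) :
    ∫ t in (0 : ℝ)..2 * Real.pi,
      Complex.exp ((-2 * Real.pi * inner ℝ v (WithLp.toLp 2 (γ t)) : ℝ) * Complex.I) =
      2 * Real.pi * ((∑' k : ℕ, (-(Real.pi ^ 2 * ‖herm (toComplex (γ 0)) (toComplex v.ofLp)‖ ^ 2)) ^ k
        / ((k.factorial : ℝ) * k.factorial) : ℝ) : ℂ) := by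
  set c := herm (toComplex (γ 0)) (toComplex v.ofLp) with hc
  -- The real part of `exp(it) c` is written as half the sum with its conjugate; the resulting
  -- coefficients have product `-π²|c|²`.
  have h1 : ∀ t : ℝ, ((-2 * Real.pi * inner ℝ v (WithLp.toLp 2 (γ t)) : ℝ) : ℂ) * Complex.I =
      (-Real.pi * Complex.I * c) * Complex.exp (t * Complex.I) +
        (-Real.pi * Complex.I * (starRingEnd ℂ) c) * Complex.exp (-(t * Complex.I)) := by
    intro t
    have h2 : inner ℝ v (WithLp.toLp 2 (γ t)) = (Complex.exp (t * Complex.I) * c).re := by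
      rw [real_inner_comm, show v = WithLp.toLp 2 v.ofLp from rfl, inner_ephase, inner_eq_re_herm,
        hγ.toComplex_eq]
      have h3 := herm_smul_smul (Complex.exp (-(t * Complex.I))) 1 (toComplex (γ 0))
        (toComplex v.ofLp)
      rw [one_smul, mul_one, RCLike.star_def, ← Complex.exp_conj, map_neg, map_mul,
        Complex.conj_ofReal, Complex.conj_I, mul_neg, neg_neg] at h3
      rw [h3]
    have h4 := Complex.add_conj (Complex.exp (t * Complex.I) * c)
    rw [map_mul, ← Complex.exp_conj, map_mul, Complex.conj_ofReal, Complex.conj_I, mul_neg] at h4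
    rw [h2]
    push_cast at h4 ⊢
    linear_combination (Real.pi * Complex.I) * h4
  simp only [h1]
  rw [integral_exp_circle]
  congr 1
  push_cast
  congr 1
  ext k
  congr 2
  rw [← Complex.conj_mul' c]
  linear_combination (Real.pi ^ 2 * c * (starRingEnd ℂ) c) * Complex.I_sq

/-- The relation `E = ħ (N + d/2)` gives `ħ → 0` and `N ħ → E`; the Gaussian factor tends to `1` and
the Laguerre factor to the Bessel series of the orbit measure. -/
theorem tendsto_charFn {E : ℝ} (hE : 0 < E) {ħ : ℕ → ℝ} (hħ : ∀ N, 0 < ħ N)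
    (hħE : ∀ N : ℕ, E = ħ N * ((N : ℝ) + (d : ℝ) / 2)) {γ : ℝ → Phase d}
    (hγ : IsHamiltonianOrbit γ) (v : EPhase d) :
    Tendsto (fun N => charFn (ħ N) N (orbitVec E γ) v) atTop
      (𝓝 ((2 * (Real.pi : ℂ))⁻¹ * ∫ t in (0 : ℝ)..2 * Real.pi,
        Complex.exp ((-2 * Real.pi * inner ℝ v (WithLp.toLp 2 (γ t)) : ℝ) * Complex.I))) := by
  have hħ0 : Tendsto ħ atTop (𝓝 0) := by
    have h1 : Tendsto (fun N : ℕ => E / N) atTop (𝓝 0) := tendsto_const_div_atTop_nhds_zero_nat E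
    refine squeeze_zero' (Eventually.of_forall fun N => (hħ N).le) ?_ h1
    filter_upwards [eventually_gt_atTop 0] with N hN
    have hN' : (0 : ℝ) < N := by exact_mod_cast hN
    rw [le_div_iff₀ hN']
    have h2 := hħE N
    have h3 : 0 ≤ ħ N * ((d : ℝ) / 2) := mul_nonneg (hħ N).le (by positivity)
    linarith
  have hNħ : Tendsto (fun N : ℕ => (N : ℝ) * ħ N) atTop (𝓝 E) := by
    have h1 : Tendsto (fun N : ℕ => E - (d : ℝ) / 2 * ħ N) atTop (𝓝 (E - (d : ℝ) / 2 * 0)) :=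
      tendsto_const_nhds.sub (hħ0.const_mul _)
    rw [mul_zero, sub_zero] at h1
    refine h1.congr fun N => ?_
    linarith [hħE N]
  rw [hγ.integral_exp, ← mul_assoc, inv_mul_cancel₀ (mul_ne_zero two_ne_zero (by exact_mod_cast Real.pi_ne_zero)),
    one_mul]
  set c := ‖herm (orbitVec E γ) (toComplex v.ofLp)‖ ^ 2 with hc
  have hcE : ‖herm (toComplex (γ 0)) (toComplex v.ofLp)‖ ^ 2 = E * c := by
    rw [hc, norm_sq_herm_orbitVec hE]
    field_simp
  rw [hcE]
  have h1 := tendsto_laguerre (x := fun N => Real.pi ^ 2 * ħ N * c)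
    (y := Real.pi ^ 2 * (E * c)) (fun N => by have := hħ N; positivity)
    (by
      have := (hNħ.const_mul (Real.pi ^ 2)).mul_const c
      rw [mul_assoc] at this
      exact this.congr fun N => by ring)
    (by simpa using (hħ0.const_mul (Real.pi ^ 2)).mul_const c)
  have h2 : Tendsto (fun N => Real.exp (-(Real.pi ^ 2 * ħ N) * ‖v‖ ^ 2)) atTop (𝓝 1) := by
    have : Tendsto (fun N => -(Real.pi ^ 2 * ħ N) * ‖v‖ ^ 2) atTop (𝓝 0) := by
      simpa using ((hħ0.const_mul (Real.pi ^ 2)).neg.mul_const (‖v‖ ^ 2))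
    have h3 := (Real.continuous_exp.tendsto 0).comp this
    rwa [Real.exp_zero] at h3
  have h3 := h1.mul h2
  rw [mul_one] at h3
  exact (Complex.continuous_ofReal.tendsto _).comp h3

/-- Convergence of the Wigner distributions against Schwartz functions. -/
theorem tendsto_integral_schwartz {E : ℝ} (hE : 0 < E) {ħ : ℕ → ℝ} (hħ : ∀ N, 0 < ħ N)
    (hħE : ∀ N : ℕ, E = ħ N * ((N : ℝ) + (d : ℝ) / 2)) {γ : ℝ → Phase d}
    (hγ : IsHamiltonianOrbit γ) (hγE : energy (γ 0) = E) {φ : ℕ → StateSpace d}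
    (hφ : ∀ N, HasLaguerreAmbiguity (ħ N) N (orbitVec E γ) (φ N)) (G : 𝓢(EPhase d, ℂ)) :
    Tendsto (fun N => ∫ v, G v * 𝓕⁻ (charFn (ħ N) N (orbitVec E γ)) v) atTop
      (𝓝 ((2 * (Real.pi : ℂ))⁻¹ * ∫ t in (0 : ℝ)..2 * Real.pi, G (WithLp.toLp 2 (γ t)))) := by
  have hζ := herm_orbitVec_self hE hγE
  -- Moving the transform onto the test function leaves an integral of characteristic functions,
  -- dominated by `‖g‖`.
  set g : 𝓢(EPhase d, ℂ) := 𝓕⁻ G with hg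
  have h1 : ∀ N, ∫ v, G v * 𝓕⁻ (charFn (ħ N) N (orbitVec E γ)) v =
      ∫ v, g v * charFn (ħ N) N (orbitVec E γ) v := by
    intro N
    have := integral_fourierInv_mul_eq G.integrable (integrable_charFn (hħ N) N hζ)
    rw [hg, SchwartzMap.fourierInv_coe, this]
  simp only [h1]
  have hlim := tendsto_integral_of_dominated_convergence (μ := (volume : Measure (EPhase d)))
    (F := fun N v => g v * charFn (ħ N) N (orbitVec E γ) v)
    (f := fun v => g v * ((2 * (Real.pi : ℂ))⁻¹ * ∫ t in (0 : ℝ)..2 * Real.pi,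
        Complex.exp ((-2 * Real.pi * inner ℝ v (WithLp.toLp 2 (γ t)) : ℝ) * Complex.I)))
    (fun v => ‖g v‖)
    (fun N => (g.continuous.mul (continuous_charFn _ _ _)).aestronglyMeasurable)
    g.integrable.norm
    (fun N => Eventually.of_forall fun v => by
      rw [norm_mul]
      exact mul_le_of_le_one_right (norm_nonneg _) ((hφ N).norm_charFn_le_one (hħ N) v))
    (Eventually.of_forall fun v => (tendsto_charFn hE hħ hħE hγ v).const_mul _)
  convert hlim using 2
  have hγc : Continuous (fun t => (WithLp.toLp 2 (γ t) : EPhase d)) :=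
    (WithLp.prod_continuous_toLp 2 _ _).comp hγ.continuous
  set K : ℝ → EPhase d → ℂ := fun t v =>
    Complex.exp ((-2 * Real.pi * inner ℝ v (WithLp.toLp 2 (γ t)) : ℝ) * Complex.I) * g v with hK
  have hKc : Continuous (Function.uncurry K) := by
    have hgc := g.continuous
    have hi : Continuous fun p : ℝ × EPhase d => inner ℝ p.2 (WithLp.toLp 2 (γ p.1)) :=
      continuous_snd.inner (hγc.comp continuous_fst)
    simp only [hK, Function.uncurry_def]
    fun_prop
  have hKint : Integrable (Function.uncurry K)
      ((volume.restrict (Set.uIoc 0 (2 * Real.pi))).prod volume) := by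
    have hdom : Integrable (fun z : ℝ × EPhase d => (1 : ℝ) * ‖g z.2‖)
        ((volume.restrict (Set.uIoc 0 (2 * Real.pi))).prod volume) := by
      refine Integrable.mul_prod (f := fun _ : ℝ => (1 : ℝ)) ?_ g.integrable.norm
      exact integrableOn_const (by simp [Set.uIoc])
    refine hdom.mono' hKc.aestronglyMeasurable (Eventually.of_forall fun z => ?_)
    simp only [hK, Function.uncurry_def, norm_mul, Complex.norm_exp_ofReal_mul_I, le_refl]
  -- Fubini turns the limit back into the Fourier transform of `g`, that is `G`, averaged over the
  -- orbit.
  have hswap := intervalIntegral_integral_swap hKint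
  have h2 : ∀ t, ∫ v, K t v = G (WithLp.toLp 2 (γ t)) := by
    intro t
    have h3 : (𝓕 g : 𝓢(EPhase d, ℂ)) = G := FourierTransform.fourier_fourierInv_eq G
    rw [← h3, SchwartzMap.fourier_coe, Real.fourier_eq']
    rfl
  simp only [h2] at hswap
  rw [hswap, ← integral_const_mul]
  refine integral_congr_ae (Eventually.of_forall fun v => ?_)
  simp only [hK]
  rw [intervalIntegral.integral_mul_const]
  ring

end Convergence

/-! ### Cut-off of the tails -/

section Tail

open scoped FourierTransform SchwartzMap

variable {d : ℕ}

theorem wignerConst_nonneg {ħ : ℝ} (hħ : 0 < ħ) (N : ℕ) : 0 ≤ wignerConst d ħ N := by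
  unfold wignerConst
  positivity

theorem integral_gaussian_ephase {ħ : ℝ} (hħ : 0 < ħ) :
    ∫ v : EPhase d, Real.exp (-(1 / (8 * ħ)) * ‖v‖ ^ 2) = (8 * Real.pi * ħ) ^ d := by
  have hfin : Module.finrank ℝ (EPhase d) = d + d := by
    rw [(WithLp.linearEquiv 2 ℝ (Phase d)).finrank_eq, Module.finrank_prod,
      finrank_euclideanSpace_fin]
  rw [GaussianFourier.integral_rexp_neg_mul_sq_norm (by positivity), hfin]
  have h1 : ((d + d : ℕ) : ℝ) / 2 = d := by
    push_cast
    ring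
  rw [h1, Real.rpow_natCast]
  congr 1
  field_simp

/-- Integrating half of the Gaussian gives `(8πħ)^d`, which reduces the prefactor `(2πħ)^(-d)` to
`4^d`. The other half is at most `exp(-24E / 8ħ) = exp(-3(N + d/2))` in the tail, and `exp 3 > 8`:
hence the radius `√(24E)`. -/
theorem wignerConst_mul_le {E ħ : ℝ} (hħ : 0 < ħ) {N : ℕ}
    (hħE : E = ħ * ((N : ℝ) + (d : ℝ) / 2)) :
    wignerConst d ħ N * Real.exp (-(24 * E) / (8 * ħ)) * (8 * Real.pi * ħ) ^ d ≤
      8 ^ ((d : ℝ) / 2) * 4 ^ d * (8 * Real.exp (-3)) ^ N := by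
  have h1 : wignerConst d ħ N * (8 * Real.pi * ħ) ^ d = 8 ^ ((d : ℝ) / 2) * 4 ^ d * 8 ^ N := by
    have h2 : (8 * Real.pi * ħ) ^ d = 4 ^ d * ((2 * Real.pi) ^ d * ħ ^ d) := by
      rw [← mul_pow, ← mul_pow]
      congr 1
      ring
    rw [wignerConst, h2]
    have : (2 * Real.pi) ^ d * ħ ^ d ≠ 0 := by positivity
    field_simp
  have h3 : Real.exp (-(24 * E) / (8 * ħ)) ≤ Real.exp (-3) ^ N := by
    rw [← Real.exp_nat_mul]
    refine Real.exp_le_exp.2 ?_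
    have h4 : -(24 * E) / (8 * ħ) = -3 * ((N : ℝ) + (d : ℝ) / 2) := by
      rw [hħE]
      field_simp
      ring
    rw [h4]
    have : (0 : ℝ) ≤ d := by positivity
    linarith
  calc _ = wignerConst d ħ N * (8 * Real.pi * ħ) ^ d * Real.exp (-(24 * E) / (8 * ħ)) := by ring
    _ ≤ 8 ^ ((d : ℝ) / 2) * 4 ^ d * 8 ^ N * Real.exp (-3) ^ N := by
        rw [h1]
        gcongr
    _ = _ := by
        rw [mul_pow]
        ring

theorem tendsto_geometric_tail (c : ℝ) :
    Tendsto (fun N : ℕ => c * (8 * Real.exp (-3)) ^ N) atTop (𝓝 0) := by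
  have h1 : 8 * Real.exp (-3) < 1 := by
    have h2 : (8 : ℝ) < Real.exp 3 := by
      have h3 : (2 : ℝ) < Real.exp 1 := by linarith [Real.exp_one_gt_d9]
      have h4 : Real.exp 3 = Real.exp 1 ^ 3 := by
        rw [← Real.exp_nat_mul]
        norm_num
      rw [h4]
      calc (8 : ℝ) = 2 ^ 3 := by norm_num
        _ < _ := by gcongr
    rw [Real.exp_neg, ← div_eq_mul_inv, div_lt_one (Real.exp_pos _)]
    exact h2
  simpa using (tendsto_pow_atTop_nhds_zero_of_lt_one (by positivity) h1).const_mul c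

/-- Bounded functions vanishing on the ball of radius `√(24 E)` do not see the Wigner
distributions in the limit. -/
theorem norm_integral_tail_le (hd : 2 ≤ d) {E ħ : ℝ} (hħ : 0 < ħ) {N : ℕ}
    (hħE : E = ħ * ((N : ℝ) + (d : ℝ) / 2)) {ζ : Fin d → ℂ} (hζ : herm ζ ζ = 2) {C : ℝ}
    {b : EPhase d → ℂ} (hb : ∀ v, ‖b v‖ ≤ C) (hb0 : ∀ v, ‖v‖ ^ 2 ≤ 24 * E → b v = 0) :
    ‖∫ v, b v * 𝓕⁻ (charFn ħ N ζ) v‖ ≤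
      C * (8 ^ ((d : ℝ) / 2) * 4 ^ d) * (8 * Real.exp (-3)) ^ N := by
  have hC : 0 ≤ C := (norm_nonneg _).trans (hb 0)
  have hB := wignerConst_nonneg (d := d) hħ N
  have h1 : ‖∫ v, b v * 𝓕⁻ (charFn ħ N ζ) v‖ ≤ ∫ v : EPhase d,
      C * (wignerConst d ħ N * Real.exp (-(24 * E) / (8 * ħ))) *
        Real.exp (-(1 / (8 * ħ)) * ‖v‖ ^ 2) := by
    refine norm_integral_le_of_norm_le
      ((integrable_exp_neg_mul_norm_sq (by positivity)).const_mul _)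
      (Eventually.of_forall fun v => ?_)
    by_cases hv : ‖v‖ ^ 2 ≤ 24 * E
    · rw [hb0 v hv, zero_mul, norm_zero]
      positivity
    · have h2 := norm_fourierInv_charFn_le hd hħ N hζ v
      have h3 : Real.exp (-‖v‖ ^ 2 / (4 * ħ)) ≤
          Real.exp (-(24 * E) / (8 * ħ)) * Real.exp (-(1 / (8 * ħ)) * ‖v‖ ^ 2) := by
        rw [← Real.exp_add]
        refine Real.exp_le_exp.2 ?_
        have h4 : -(24 * E) / (8 * ħ) + -(1 / (8 * ħ)) * ‖v‖ ^ 2 - -‖v‖ ^ 2 / (4 * ħ) =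
            (‖v‖ ^ 2 - 24 * E) / (8 * ħ) := by
          field_simp
          ring
        have h5 : 0 ≤ (‖v‖ ^ 2 - 24 * E) / (8 * ħ) :=
          div_nonneg (by linarith) (by positivity)
        linarith
      rw [norm_mul]
      calc _ ≤ C * (wignerConst d ħ N * Real.exp (-‖v‖ ^ 2 / (4 * ħ))) :=
            mul_le_mul (hb v) h2 (norm_nonneg _) hC
        _ ≤ C * (wignerConst d ħ N * (Real.exp (-(24 * E) / (8 * ħ)) *
            Real.exp (-(1 / (8 * ħ)) * ‖v‖ ^ 2))) := by gcongr
        _ = _ := by ring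
  rw [integral_const_mul, integral_gaussian_ephase hħ] at h1
  refine h1.trans ?_
  have h6 := mul_le_mul_of_nonneg_left (wignerConst_mul_le hħ hħE) hC
  calc _ = C * (wignerConst d ħ N * Real.exp (-(24 * E) / (8 * ħ)) * (8 * Real.pi * ħ) ^ d) := by
        ring
    _ ≤ _ := h6
    _ = _ := by ring

theorem integrable_mul_fourierInv_charFn (hd : 2 ≤ d) {ħ : ℝ} (hħ : 0 < ħ) (N : ℕ)
    {ζ : Fin d → ℂ} (hζ : herm ζ ζ = 2) {C : ℝ} {b : EPhase d → ℂ} (hbc : Continuous b)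
    (hb : ∀ v, ‖b v‖ ≤ C) : Integrable (fun v => b v * 𝓕⁻ (charFn ħ N ζ) v) := by
  have hW : Integrable (𝓕⁻ (charFn ħ N ζ)) := by
    refine ((integrable_exp_neg_mul_norm_sq (V := EPhase d) (b := 1 / (4 * ħ))
      (by positivity)).const_mul (wignerConst d ħ N)).mono'
      (continuous_fourierInv (integrable_charFn hħ N hζ)).aestronglyMeasurable
      (Eventually.of_forall fun v => ?_)
    convert norm_fourierInv_charFn_le hd hħ N hζ v using 3
    ring
  exact hW.bdd_mul (c := C) hbc.aestronglyMeasurable (Eventually.of_forall hb)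

/-- Convergence of the Wigner distributions against bounded smooth functions. -/
theorem tendsto_integral_bounded (hd : 2 ≤ d) {E : ℝ} (hE : 0 < E) {ħ : ℕ → ℝ}
    (hħ : ∀ N, 0 < ħ N) (hħE : ∀ N : ℕ, E = ħ N * ((N : ℝ) + (d : ℝ) / 2)) {γ : ℝ → Phase d}
    (hγ : IsHamiltonianOrbit γ) (hγE : ∀ t, energy (γ t) = E) {φ : ℕ → StateSpace d}
    (hφ : ∀ N, HasLaguerreAmbiguity (ħ N) N (orbitVec E γ) (φ N)) {b : EPhase d → ℂ}
    (hbd : ContDiff ℝ ∞ b) {C : ℝ} (hb : ∀ v, ‖b v‖ ≤ C) :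
    Tendsto (fun N => ∫ v, b v * 𝓕⁻ (charFn (ħ N) N (orbitVec E γ)) v) atTop
      (𝓝 ((2 * (Real.pi : ℂ))⁻¹ * ∫ t in (0 : ℝ)..2 * Real.pi, b (WithLp.toLp 2 (γ t)))) := by
  have hζ := herm_orbitVec_self hE (hγE 0)
  have hR : 0 < √(24 * E) := Real.sqrt_pos.2 (by positivity)
  -- The orbit has radius `√(2E)`, well inside the ball where `χ = 1`, so the cut-off does not
  -- change the limit.
  set χ : ContDiffBump (0 : EPhase d) := ⟨√(24 * E), √(24 * E) + 1, hR, by linarith⟩ with hχ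
  have hχ1 : ∀ v : EPhase d, ‖v‖ ^ 2 ≤ 24 * E → χ v = 1 := by
    intro v hv
    refine χ.one_of_mem_closedBall ?_
    rw [mem_closedBall_zero_iff]
    exact Real.le_sqrt_of_sq_le hv
  have hcs : HasCompactSupport (fun v => (χ v : ℂ) * b v) :=
    (χ.hasCompactSupport.comp_left (g := Complex.ofReal) Complex.ofReal_zero).mul_right
  have hcd : ContDiff ℝ ∞ (fun v => (χ v : ℂ) * b v) :=
    (Complex.ofRealCLM.contDiff.comp χ.contDiff).mul hbd
  set G : 𝓢(EPhase d, ℂ) := hcs.toSchwartzMap hcd with hG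
  have hGv : ∀ v, G v = (χ v : ℂ) * b v := fun v => rfl
  have hGle : ∀ v, ‖G v‖ ≤ C := by
    intro v
    rw [hGv, norm_mul, Complex.norm_real, Real.norm_of_nonneg χ.nonneg]
    exact (mul_le_of_le_one_left (norm_nonneg _) χ.le_one).trans (hb v)
  have h1 := tendsto_integral_schwartz hE hħ hħE hγ (hγE 0) hφ G
  have h2 : ∀ t, G (WithLp.toLp 2 (γ t)) = b (WithLp.toLp 2 (γ t)) := by
    intro t
    rw [hGv, hχ1, Complex.ofReal_one, one_mul]
    have h3 := hγE t
    rw [energy] at h3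
    rw [norm_sq_ephase]
    change ‖(γ t).1‖ ^ 2 + ‖(γ t).2‖ ^ 2 ≤ 24 * E
    linarith
  simp only [h2] at h1
  -- The remainder `b - G` is bounded and vanishes on the ball of radius `√(24E)`, so it falls under
  -- the tail estimate.
  have h4 : Tendsto (fun N => ∫ v, (b v - G v) * 𝓕⁻ (charFn (ħ N) N (orbitVec E γ)) v) atTop
      (𝓝 0) := by
    refine squeeze_zero_norm (fun N => ?_)
      (tendsto_geometric_tail (C * (8 ^ ((d : ℝ) / 2) * 4 ^ d)))
    refine norm_integral_tail_le hd (hħ N) (hħE N) hζ (fun v => ?_) fun v hv => ?_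
    · rw [hGv, ← one_sub_mul, norm_mul, ← Complex.ofReal_one, ← Complex.ofReal_sub,
        Complex.norm_real, Real.norm_of_nonneg (sub_nonneg.2 χ.le_one)]
      exact (mul_le_of_le_one_left (norm_nonneg _) (sub_le_self _ χ.nonneg)).trans (hb v)
    · rw [hGv, hχ1 v hv, Complex.ofReal_one, one_mul, sub_self]
  have h5 := h1.add h4
  rw [add_zero] at h5
  refine h5.congr fun N => ?_
  have hsub : ∀ v, ‖b v - G v‖ ≤ C + C := fun v =>
    (norm_sub_le _ _).trans (add_le_add (hb v) (hGle v))
  rw [← integral_add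
    (integrable_mul_fourierInv_charFn hd (hħ N) N hζ G.continuous hGle)
    (integrable_mul_fourierInv_charFn (b := fun v => b v - G v) hd (hħ N) N hζ
      (hbd.continuous.sub G.continuous) hsub)]
  refine integral_congr_ae (Eventually.of_forall fun v => ?_)
  ring

end Tail

end OrbitalCoherent

theorem proposition4p1 (d : ℕ) (hd : 2 ≤ d) (E : ℝ) (hE : 0 < E)
    (ħ : ℕ → ℝ) (hħ : ∀ N, 0 < ħ N) (hħE : ∀ N : ℕ, E = ħ N * ((N : ℝ) + (d : ℝ) / 2))
    (γ : ℝ → Phase d) (hγ : IsHamiltonianOrbit γ) (hγE : ∀ t, energy (γ t) = E) :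
    (∀ N, ∃ φ : StateSpace d, IsOrbitalCoherentState hd E (hħ N) N γ φ) ∧
    ∀ φ : ℕ → StateSpace d, (∀ N, IsOrbitalCoherentState hd E (hħ N) N γ (φ N)) →
      ∀ a : Phase d → ℝ, ContDiff ℝ ∞ a → HasExponentialDecay a →
        (∀ N, Integrable (fun z => (a z : ℂ) * wigner (ħ N) (φ N) z) volume) ∧
        Tendsto (fun N => ∫ z, (a z : ℂ) * wigner (ħ N) (φ N) z) atTop
          (𝓝 (((1 / (2 * Real.pi)) * ∫ t in (0 : ℝ)..(2 * Real.pi), a (γ t) : ℝ) : ℂ)) := by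
  refine ⟨fun N => exists_isOrbitalCoherentState hd hE (hħ N) N hγ (hγE 0),
    fun φ hφ a ha hdec => ?_⟩
  obtain ⟨C, c, hc, hC⟩ := hdec
  have hφ' : ∀ N, HasLaguerreAmbiguity (ħ N) N (orbitVec E γ) (φ N) := fun N =>
    (hφ N).hasLaguerreAmbiguity hE hγ
  have hζ := herm_orbitVec_self hE (hγE 0)
  set b : EPhase d → ℂ := fun v => (a v.ofLp : ℂ) with hb
  have hbd : ContDiff ℝ ∞ b :=
    Complex.ofRealCLM.contDiff.comp
      (ha.comp (WithLp.prodContinuousLinearEquiv 2 ℝ (Conf d) (Conf d)).contDiff)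
  -- The exponential decay enters through this uniform bound.
  have hbC : ∀ v, ‖b v‖ ≤ |C| := by
    intro v
    rw [hb, Complex.norm_real, Real.norm_eq_abs]
    refine (hC v.ofLp).trans ?_
    have h1 : Real.exp (-c * (‖v.ofLp.1‖ + ‖v.ofLp.2‖)) ≤ 1 := by
      rw [Real.exp_le_one_iff]
      have : 0 ≤ c * (‖v.ofLp.1‖ + ‖v.ofLp.2‖) := by positivity
      linarith
    calc _ ≤ |C| * Real.exp (-c * (‖v.ofLp.1‖ + ‖v.ofLp.2‖)) := by
          gcongr
          exact le_abs_self C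
      _ ≤ |C| := mul_le_of_le_one_right (abs_nonneg _) h1
  have hae : ∀ N, (fun z : Phase d => (a z : ℂ) * wigner (ħ N) (φ N) z) =ᵐ[volume] fun z =>
      b (WithLp.toLp 2 z) *
        FourierTransformInv.fourierInv (charFn (ħ N) N (orbitVec E γ)) (WithLp.toLp 2 z) := by
    intro N
    filter_upwards [wigner_ae_eq_fourierInv_charFn (hħ N) hζ (hφ' N)] with z hz
    rw [hz]
  refine ⟨fun N => ?_, ?_⟩
  · refine Integrable.congr ?_ (hae N).symm
    exact (integrable_ephase_iff _).1
      (integrable_mul_fourierInv_charFn hd (hħ N) N hζ hbd.continuous hbC)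
  · have h1 := tendsto_integral_bounded hd hE hħ hħE hγ hγE hφ' hbd hbC
    have h2 : (((1 / (2 * Real.pi)) * ∫ t in (0 : ℝ)..(2 * Real.pi), a (γ t) : ℝ) : ℂ) =
        (2 * (Real.pi : ℂ))⁻¹ * ∫ t in (0 : ℝ)..2 * Real.pi, b (WithLp.toLp 2 (γ t)) := by
      rw [Complex.ofReal_mul, ← intervalIntegral.integral_ofReal]
      push_cast
      rw [one_div]
    rw [h2]
    refine h1.congr fun N => ?_
    rw [integral_congr_ae (hae N), integral_ephase]
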